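/- **Theorem (Controlizing 2-local Hamiltonians).** Fix $d\ge 2$ and let $\mathcal H=(\mathbb C^d)^{\otimes n}$. Call $H\in\mathcal L(\mathcal H)$ a 2-local Hamiltonian if it is a sum of traceless Hermitian operators each of which acts on at most two of the $n$ qudits. Let $X=\sum_{x}|x+1 \bmod d\rangle\langle x|$, $Z=\mathrm{diag}(1,\omega,\dots,\omega^{d-1})$ with $\omega=e^{2\pi i/d}$; the generalized Pauli matrices are $P_{(a,b)}=X^aZ^b$, $0\le a,b<d$. For an operator $V$ on $\mathcal H$ put $\Lambda(V)=|0\rangle\langle0|\otimes V+|1\rangle\langle1|\otimes I$; a controlled generalized Pauli is an operator $\Lambda(\omega^c P_{m_1}\otimes\cdots\otimes P_{m_n})$ with $c\in\{0,\dots,d-1\}$. Let $\mathrm{ctrl}(U)=|0\rangle\langle0|\otimes I+|1\rangle\langle1|\otimes U$, and let $\|\cdot\|$ be the spectral norm. There is a constant $C>0$ depending only on $d$ such that for every $n\ge1$ there are $N\ge 1$ with $N\le Cn$ and an orthogonal array $OA(N,n,d^2,2)$ with entries $m_{ji}\in\{0,\dots,d-1\}^2$ (in every two columns, each pair of symbols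 occurs in exactly $N/d^4$ rows) with the following property. Put $U_j=P_{m_{j1}}\otimes\cdots\otimes P_{m_{jn}}$ and $H_j=\frac1N\,\Lambda(U_j)(I_2\otimes H)\Lambda(U_j)^\dagger$ for $j=1,\dots,N$. For all $t\ge 0$, $J\ge0$ and $\varepsilon>0$: 1. (first order) there are $r\ge1$ and a circuit composed of black-box uses of the uncontrolled evolution $I_2\otimes e^{-iH\tau}$ with times $\tau\ge0$ and of at most $$C\,n\,\max\Big\{1,\ \frac{t^2J^2}{\varepsilon}\Big\}$$ controlled generalized Paulis, such that for every 2-local Hamiltonian $H$ with $\|H\|\le J$ the circuit realizes the unitary $\tilde U=\big(e^{-iH_Nt/r}\cdots e^{-iH_1t/r}\big)^r$, and $\|\tilde U-\mathrm{ctrl}(e^{-iHt})\|\le\varepsilon$; 2. (second order) there are $r\ge1$ and such a circuit with at most $$C\,n\,\max\Big\{1,\ \frac{t^{3/2}J^{3/2}}{\varepsilon^{1/2}}\Big\}$$ controlled generalized Paulis, such that for every 2-local Hamiltonian $H$ with $\|H\|\le J$ the circuit realizes the unitary $\tilde U=\big(e^{-iH_1\frac{t}{2r}}\cdots e^{-iH_N\frac{t}{2r}}\cdot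 e^{-iH_N\frac{t}{2r}}\cdots e^{-iH_1\frac{t}{2r}}\big)^r$, and $\|\tilde U-\mathrm{ctrl}(e^{-iHt})\|\le\varepsilon$. The circuits (their length, gates and times) depend on $d,n,t,J,\varepsilon$ but not on $H$. In particular one may take $J=\|H\|$; so $O(nt^2\|H\|^2/\varepsilon)$, respectively $O(nt^{3/2}\|H\|^{3/2}/\varepsilon^{1/2})$, controlled generalized Paulis suffice whenever $t^2\|H\|^2/\varepsilon\ge1$, respectively $t^{3/2}\|H\|^{3/2}/\varepsilon^{1/2}\ge1$. -/

import Mathlib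

open scoped Kronecker NNReal Matrix.Norms.L2Operator

noncomputable section

namespace Controlization

/-- Linear operators on `(ℂ^d)^{⊗ n}`, written as matrices in the computational basis, whose
elements are the strings `x : Fin n → Fin d`.  The norm on matrices in this file is the spectral
norm (operator norm for the Euclidean norm). -/
abbrev Op (n d : ℕ) : Type := Matrix (Fin n → Fin d) (Fin n → Fin d) ℂ

/-- Linear operators on `ℂ^2 ⊗ (ℂ^d)^{⊗ n}` (control qubit first). -/
abbrev CtrlOp (n d : ℕ) : Type :=
  Matrix (Fin 2 × (Fin n → Fin d)) (Fin 2 × (Fin n → Fin d)) ℂ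

/-! ### Local Hamiltonians -/

/-- The operator `B` on the qudits in `S`, tensored with the identity on all other qudits. -/
def embed {n d : ℕ} (S : Finset (Fin n)) (B : Matrix (S → Fin d) (S → Fin d) ℂ) : Op n d :=
  Matrix.of fun x y =>
    if ∀ i, i ∉ S → x i = y i then B (fun i => x i) (fun i => y i) else 0

/-- `A` acts only on the qudits in `S`. -/
def ActsOnlyOn {n d : ℕ} (S : Finset (Fin n)) (A : Op n d) : Prop :=
  ∃ B : Matrix (S → Fin d) (S → Fin d) ℂ, A = embed S B

/-- `H` is a sum of traceless Hermitian terms, each acting on at most `k` qudits.  (If `k ≤ n`,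
each of these terms can be regarded as acting on exactly `k` qudits, so that one may as well sum
over the `k`-element sets of qudits.) -/
def IsLocalHamiltonian {n d : ℕ} (k : ℕ) (H : Op n d) : Prop :=
  ∃ h : Finset (Fin n) → Op n d,
    (∀ S : Finset (Fin n), S.card ≤ k →
      ActsOnlyOn S (h S) ∧ (h S).IsHermitian ∧ (h S).trace = 0) ∧
    H = ∑ S ∈ Finset.univ.filter (fun S : Finset (Fin n) => S.card ≤ k), h S

/-! ### Generalized Pauli matrices -/

/-- The root of unity `ω = exp (2 π i / d)`. -/
def omega (d : ℕ) : ℂ := Complex.exp (2 * Real.pi * Complex.I / d)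

/-- The cyclic shift `X = ∑ x, |x + 1 mod d⟩⟨x|`. -/
def shiftX (d : ℕ) : Matrix (Fin d) (Fin d) ℂ :=
  Matrix.of fun y x => if (y : ℕ) = ((x : ℕ) + 1) % d then 1 else 0

/-- The clock matrix `Z = diag (ω^0, …, ω^(d-1))`. -/
def clockZ (d : ℕ) : Matrix (Fin d) (Fin d) ℂ :=
  Matrix.diagonal fun x => omega d ^ (x : ℕ)

/-- The generalized Pauli matrix `X^a Z^b` on one qudit. -/
def pauli (d : ℕ) (p : Fin d × Fin d) : Matrix (Fin d) (Fin d) ℂ :=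
  shiftX d ^ (p.1 : ℕ) * clockZ d ^ (p.2 : ℕ)

/-- The `n`-fold tensor product of generalized Pauli matrices. -/
def pauliString {n d : ℕ} (m : Fin n → Fin d × Fin d) : Op n d :=
  Matrix.of fun x y => ∏ i, pauli d (m i) (x i) (y i)

/-! ### Controlled operators -/

/-- `Λ(V) = |0⟩⟨0| ⊗ V + |1⟩⟨1| ⊗ I`. -/
def lam {n d : ℕ} (V : Op n d) : CtrlOp n d :=
  Matrix.single (0 : Fin 2) (0 : Fin 2) (1 : ℂ) ⊗ₖ V +
    Matrix.single (1 : Fin 2) (1 : Fin 2) (1 : ℂ) ⊗ₖ (1 : Op n d)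

/-- `ctrl(U) = |0⟩⟨0| ⊗ I + |1⟩⟨1| ⊗ U`. -/
def ctrl {n d : ℕ} (U : Op n d) : CtrlOp n d :=
  Matrix.single (0 : Fin 2) (0 : Fin 2) (1 : ℂ) ⊗ₖ (1 : Op n d) +
    Matrix.single (1 : Fin 2) (1 : Fin 2) (1 : ℂ) ⊗ₖ U

/-- The time evolution `exp (-i A τ)`. -/
def evolution {ι : Type*} [Fintype ι] [DecidableEq ι] (A : Matrix ι ι ℂ) (τ : ℝ) :
    Matrix ι ι ℂ :=
  NormedSpace.exp ((-(Complex.I * (τ : ℂ))) • A)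

/-! ### Circuits with black-box access to the evolution -/

/-- The available operations: a call of the black box, i.e. the uncontrolled evolution for a time
`τ ≥ 0`, and a controlled generalized Pauli `Λ(ω^c • P)`, where `P` is an `n`-fold tensor product
of generalized Pauli matrices.  (The powers of `ω` make this set closed under inverses.) -/
inductive Gate (n d : ℕ) : Type
  | blackBox (τ : ℝ≥0) : Gate n d
  | ctrlPauli (c : Fin d) (m : Fin n → Fin d × Fin d) : Gate n d

/-- The operator of a gate when the black box holds the Hamiltonian `H`. -/
def Gate.toOp {n d : ℕ} (H : Op n d) : Gate n d → CtrlOp n d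
  | .blackBox τ => (1 : Matrix (Fin 2) (Fin 2) ℂ) ⊗ₖ evolution H (τ : ℝ)
  | .ctrlPauli c m => lam (omega d ^ (c : ℕ) • pauliString m)

/-- Whether a gate is a controlled generalized Pauli. -/
def Gate.isCtrlPauli {n d : ℕ} : Gate n d → Bool
  | .blackBox _ => false
  | .ctrlPauli _ _ => true

/-- A circuit is a list of gates, in the order of the operator product (the last one in the list
is applied first).  It does not depend on the Hamiltonian in the black box. -/
abbrev Circuit (n d : ℕ) : Type := List (Gate n d)

/-- The operator which the circuit realizes when the black box holds `H`. -/
def Circuit.toOp {n d : ℕ} (c : Circuit n d) (H : Op n d) : CtrlOp n d :=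
  (c.map (Gate.toOp H)).prod

/-- The number of controlled generalized Paulis in the circuit. -/
def Circuit.paulis {n d : ℕ} (c : Circuit n d) : ℕ :=
  c.countP Gate.isCtrlPauli

/-! ### Orthogonal arrays and the product formulas -/

/-- The `N × n` array `M` over the alphabet `α` is an orthogonal array `OA(N, n, |α|, k)`:
for each choice of `k` columns, each `k`-tuple of symbols occurs in exactly `N / |α|^k` rows. -/
def IsOrthogonalArray {N n : ℕ} {α : Type*} [Fintype α] [DecidableEq α]
    (M : Fin N → Fin n → α) (k : ℕ) : Prop :=
  ∀ S : Finset (Fin n), S.card = k → ∀ v : S → α,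
    (Finset.univ.filter fun j : Fin N => ∀ i : S, M j i = v i).card * Fintype.card α ^ k = N

/-- The terms `(1/N) Λ(U_j) (I₂ ⊗ H) Λ(U_j)†`, where `U_j` is the tensor product of generalized
Pauli matrices given by the `j`th row of the array `M`. -/
def ctrlTerm {N n d : ℕ} (M : Fin N → Fin n → Fin d × Fin d) (H : Op n d) (j : Fin N) :
    CtrlOp n d :=
  (1 / (N : ℂ)) • (lam (pauliString (M j)) * ((1 : Matrix (Fin 2) (Fin 2) ℂ) ⊗ₖ H) *
    (lam (pauliString (M j))).conjTranspose)

/-- First-order Trotter formula `(e^{-i A_N t/r} ⋯ e^{-i A_1 t/r})^r`. -/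
def trotter₁ {ι : Type*} [Fintype ι] [DecidableEq ι] {N : ℕ} (A : Fin N → Matrix ι ι ℂ)
    (t : ℝ) (r : ℕ) : Matrix ι ι ℂ :=
  (List.ofFn fun j => evolution (A j) (t / r)).reverse.prod ^ r

/-- Second-order Trotter formula
`(e^{-i A_1 t/(2r)} ⋯ e^{-i A_N t/(2r)} e^{-i A_N t/(2r)} ⋯ e^{-i A_1 t/(2r)})^r`. -/
def trotter₂ {ι : Type*} [Fintype ι] [DecidableEq ι] {N : ℕ} (A : Fin N → Matrix ι ι ℂ)
    (t : ℝ) (r : ℕ) : Matrix ι ι ℂ :=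
  ((List.ofFn fun j => evolution (A j) (t / (2 * r))).prod *
    (List.ofFn fun j => evolution (A j) (t / (2 * r))).reverse.prod) ^ r

end Controlization

end

/-!
The terms `(1/N) Λ(U_j) (I ⊗ H) Λ(U_j)†` have the blocks `(1/N) U_j H U_j†` and `(1/N) H`.  When the
rows of the array are uniformly distributed on pairs of columns, averaging a two-local traceless
operator over the `U_j` gives the same result as averaging over all generalized Pauli strings, and
that is zero (`sum_pauliString_conj_eq_zero_of_isLocalHamiltonian`).  Hence the terms add up to
`|1⟩⟨1| ⊗ H` (`sum_ctrlTerm`), whose evolution is `ctrl (e^{-iHt})`, and the claim is about the error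
of Trotter formulas for this sum.

The total norm of the terms is at most `‖H‖`, whatever `N` is.  In a Banach algebra, the Taylor
remainders of `∏ e^{A_j}` are dominated by those of the scalar `e^{∑ ‖A_j‖}`
(`norm_prod_exp_sub_one_sub_le`, `norm_prod_exp_sub_one_sub_sub_le`), and for a symmetric product the
terms of degree two agree with those of `e^{∑ A_j}` (`quadraticPart_of_reverse_eq`).  For unitary
factors this bounds the error of one step of length `t/r` by `2 (tJ/r)^2`, respectively
`2 (tJ/r)^3`; the error of `r` steps is at most `r` times that, which determines `r`.  Each
exponential takes two controlled generalized Paulis, because the adjoint of a generalized Pauli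
string is one as well, up to a power of `ω` (`exists_pauliString_conjTranspose`).

It remains to find arrays of strength two with `O(n)` rows over an alphabet of `s = d²` symbols, where
`s` need not be a prime power (`exists_linear_array`).  They come from generalized conference
matrices: for a finite field `F` with `s ∣ |F| - 1` there is a surjective character
`χ : Fˣ → ZMod s`, and in the matrix `χ (x - i)`, with `x` in the projective line and `i ∈ F`, the
difference of two columns takes each value equally often (`card_conferenceMatrix_sub`).  Adding
all constants `a` to the rows would make pairs of columns uniform, but for the missing entries at
`x = i`.  Filling these with a second, independent symbol `b` repairs this, at the cost of
`(|F| + 1) s²` rows for `|F|` columns.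
-/

namespace Controlization

/-! ### Linear-size orthogonal arrays over an arbitrary alphabet -/

/-- A discrete logarithm modulo `s`: if `s` divides the order of the multiplicative group of a
finite field, then this cyclic group maps onto `ZMod s`, with all fibres of the same size. -/
theorem exists_monoidHom_zmod_card_fiber (F : Type*) [Field F] [Fintype F] [DecidableEq F]
    (s : ℕ) [NeZero s] (hs : s ∣ Fintype.card F - 1) :
    ∃ χ : Fˣ →* Multiplicative (ZMod s), ∀ g : ZMod s,
      (Finset.univ.filter fun y : Fˣ => (χ y).toAdd = g).card * s = Fintype.card F - 1 := by
  have hcard : Nat.card Fˣ = Fintype.card F - 1 := by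
    rw [Nat.card_eq_fintype_card, Fintype.card_units]
  have hdvd : s ∣ Nat.card Fˣ := hcard ▸ hs
  let e := zmodCyclicMulEquiv (inferInstance : IsCyclic Fˣ)
  let χ : Fˣ →* Multiplicative (ZMod s) :=
    (AddMonoidHom.toMultiplicative (ZMod.castHom hdvd (ZMod s)).toAddMonoidHom).comp
      e.symm.toMonoidHom
  have hsurj : Function.Surjective χ := by
    refine Function.Surjective.comp (g := AddMonoidHom.toMultiplicative
      (ZMod.castHom hdvd (ZMod s)).toAddMonoidHom) ?_ e.symm.surjective
    exact ZMod.castHom_surjective hdvd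
  refine ⟨χ, fun g => ?_⟩
  have hfib : ∀ g' ∈ (Finset.univ : Finset (ZMod s)),
      (Finset.univ.filter fun y : Fˣ => (χ y).toAdd = g').card =
        (Finset.univ.filter fun y : Fˣ => (χ y).toAdd = g).card := by
    intro g' _
    exact MonoidHom.card_fiber_eq_of_mem_range χ (hsurj (Multiplicative.ofAdd g'))
      (hsurj (Multiplicative.ofAdd g))
  have hsum := Finset.card_eq_sum_card_fiberwise (s := (Finset.univ : Finset Fˣ))
    (t := (Finset.univ : Finset (ZMod s))) (f := fun y => (χ y).toAdd) (fun _ _ => by simp)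
  rw [Finset.sum_congr rfl hfib, Finset.sum_const, Finset.card_univ, Finset.card_univ,
    ZMod.card, smul_eq_mul, Fintype.card_units] at hsum
  rw [hsum, mul_comm]

section ConferenceArray

variable {F : Type*} [Field F] [DecidableEq F] {G : Type*} [AddCommGroup G]

/-- The generalized conference matrix of a character `χ` of `Fˣ` with values in `G`.  Its rows are
the points of the projective line over `F` and its columns the elements of `F`; the entry at
`(x, i)` is `χ (x - i)`, the row at infinity is constant, and the entries at `(i, i)`, which have
the value `0` here, are to be regarded as missing. -/
noncomputable def conferenceMatrix (χ : Fˣ →* Multiplicative G) : Option F → F → G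
  | none, _ => 0
  | some x, i => if h : x - i = 0 then 0 else (χ (Units.mk0 (x - i) h)).toAdd

@[simp]
theorem conferenceMatrix_none (χ : Fˣ →* Multiplicative G) (i : F) :
    conferenceMatrix χ none i = 0 := rfl

/-- The orthogonal array obtained from a generalized conference matrix: each row `x` is replaced by
the rows `(x, a, b)`, `a, b ∈ G`, in which `a` is added to the entries of the row `x`, and the
missing entry is replaced by `b`. -/
noncomputable def conferenceArray (χ : Fˣ →* Multiplicative G) (r : Option F × G × G) (i : F) : G :=
  if r.1 = some i then r.2.2 else r.2.1 + conferenceMatrix χ r.1 i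

/-- Differences of two columns of the conference matrix: each value is taken as often as on
`Fˣ`.  Apart from the two missing entries, the differences are the values of `χ` at the
`(x - i) / (x - i')`, that is at all elements of `Fˣ` but `1`, and the row at infinity
contributes the value at `1`. -/
theorem card_conferenceMatrix_sub [Fintype F] [DecidableEq G] (χ : Fˣ →* Multiplicative G)
    {i i' : F} (hi : i ≠ i') (g : G) :
    (Finset.univ.filter fun x : Option F => (x ≠ some i ∧ x ≠ some i') ∧
      conferenceMatrix χ x i - conferenceMatrix χ x i' = g).card =
    (Finset.univ.filter fun y : Fˣ => (χ y).toAdd = g).card := by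
  have hi0 : i - i' ≠ 0 := sub_ne_zero.2 hi
  refine Finset.card_bij
    (fun x _ => match x with
      | none => 1
      | some x => if h : x - i = 0 ∨ x - i' = 0 then 1
          else Units.mk0 (x - i) (fun h' => h (Or.inl h')) /
            Units.mk0 (x - i') (fun h' => h (Or.inr h'))) ?_ ?_ ?_
  · rintro (_ | x) hx
    · simpa using (Finset.mem_filter.1 hx).2.2
    · simp only [Finset.mem_filter, Finset.mem_univ, true_and, ne_eq, Option.some.injEq] at hx
      obtain ⟨⟨h1, h2⟩, h3⟩ := hx
      have h1' : x - i ≠ 0 := sub_ne_zero.2 h1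
      have h2' : x - i' ≠ 0 := sub_ne_zero.2 h2
      simp only [conferenceMatrix, h1', h2', dite_false] at h3
      simp [h1', h2', h3]
  · have key : ∀ x : F, x - i ≠ 0 → x - i' ≠ 0 → (x - i) / (x - i') ≠ 1 := by
      intro x _ h2 h
      rw [div_eq_one_iff_eq h2] at h
      exact hi (by linear_combination -h)
    rintro (_ | x) hx (_ | z) hz h
    · rfl
    · simp only [Finset.mem_filter, Finset.mem_univ, true_and, ne_eq, Option.some.injEq] at hz
      have h1' : z - i ≠ 0 := sub_ne_zero.2 hz.1.1
      have h2' : z - i' ≠ 0 := sub_ne_zero.2 hz.1.2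
      have := congrArg Units.val h
      simp only [h1', h2', or_self, dite_false] at this
      simp only [Units.val_one, Units.val_div_eq_div_val, Units.val_mk0] at this
      exact absurd this.symm (key z h1' h2')
    · simp only [Finset.mem_filter, Finset.mem_univ, true_and, ne_eq, Option.some.injEq] at hx
      have h1' : x - i ≠ 0 := sub_ne_zero.2 hx.1.1
      have h2' : x - i' ≠ 0 := sub_ne_zero.2 hx.1.2
      have := congrArg Units.val h
      simp only [h1', h2', or_self, dite_false] at this
      simp only [Units.val_one, Units.val_div_eq_div_val, Units.val_mk0] at this
      exact absurd this (key x h1' h2')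
    · simp only [Finset.mem_filter, Finset.mem_univ, true_and, ne_eq, Option.some.injEq] at hx hz
      have h1' : x - i ≠ 0 := sub_ne_zero.2 hx.1.1
      have h2' : x - i' ≠ 0 := sub_ne_zero.2 hx.1.2
      have h3' : z - i ≠ 0 := sub_ne_zero.2 hz.1.1
      have h4' : z - i' ≠ 0 := sub_ne_zero.2 hz.1.2
      have := congrArg Units.val h
      simp only [h1', h2', h3', h4', or_self, dite_false, Units.val_div_eq_div_val,
        Units.val_mk0] at this
      rw [div_eq_div_iff h2' h4'] at this
      have h5 : (i - i') * (x - z) = 0 := by linear_combination this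
      rw [sub_eq_zero.1 ((mul_eq_zero.1 h5).resolve_left hi0)]
  · intro y hy
    by_cases hy1 : y = 1
    · subst hy1
      refine ⟨none, ?_, rfl⟩
      simpa using hy
    · have hy1' : (1 : F) - y ≠ 0 := by
        rw [sub_ne_zero]; exact fun h => hy1 (Units.ext h.symm)
      -- the solution `x` of `(x - i) / (x - i') = y`
      obtain ⟨x, hx⟩ : ∃ x : F, x = (i - y * i') / (1 - y) := ⟨_, rfl⟩
      have e1 : x - i = y * (i - i') / (1 - y) := by rw [hx]; field_simp; ring
      have e2 : x - i' = (i - i') / (1 - y) := by rw [hx]; field_simp; ring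
      have h1' : x - i ≠ 0 := by
        rw [e1]; exact div_ne_zero (mul_ne_zero y.ne_zero hi0) hy1'
      have h2' : x - i' ≠ 0 := by rw [e2]; exact div_ne_zero hi0 hy1'
      have hq : Units.mk0 (x - i) h1' / Units.mk0 (x - i') h2' = y := by
        ext
        rw [Units.val_div_eq_div_val, Units.val_mk0, Units.val_mk0, e1, e2]
        field_simp
      refine ⟨some x, ?_, by simp [h1', h2', hq]⟩
      simp only [Finset.mem_filter, Finset.mem_univ, true_and] at hy ⊢
      refine ⟨⟨fun h => h1' ?_, fun h => h2' ?_⟩, ?_⟩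
      · rw [Option.some.inj h, sub_self]
      · rw [Option.some.inj h, sub_self]
      · simp only [conferenceMatrix, h1', h2', dite_false]
        rw [← toAdd_div, ← map_div, hq, hy]

/-- In one column of the conference array, each symbol occurs equally often. -/
theorem card_conferenceArray_eq [Fintype F] [Fintype G] [DecidableEq G]
    (χ : Fˣ →* Multiplicative G) (i : F) (u : G) :
    (Finset.univ.filter fun r : Option F × G × G => conferenceArray χ r i = u).card =
      (Fintype.card F + 1) * Fintype.card G := by
  have hrow : ∀ x : Option F, (Finset.univ.filter fun ab : G × G =>
      conferenceArray χ (x, ab) i = u).card = Fintype.card G := by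
    intro x
    by_cases hx : x = some i
    · have : (Finset.univ.filter fun ab : G × G => conferenceArray χ (x, ab) i = u) =
          Finset.univ ×ˢ {u} := by
        ext ⟨a, b⟩; simp [conferenceArray, hx, eq_comm]
      rw [this, Finset.card_product]; simp
    · have : (Finset.univ.filter fun ab : G × G => conferenceArray χ (x, ab) i = u) =
          {u - conferenceMatrix χ x i} ×ˢ Finset.univ := by
        ext ⟨a, b⟩; simp [conferenceArray, hx, eq_sub_iff_add_eq, -Finset.singleton_product]
      rw [this, Finset.card_product]; simp
  rw [Finset.card_filter, Fintype.sum_prod_type]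
  simp_rw [← Finset.card_filter, hrow]
  simp

/-- In two columns of the conference array, each pair of symbols occurs equally often, provided
that the fibres of `χ` have the same size. -/
theorem card_conferenceArray_eq_and [Fintype F] [Fintype G] [DecidableEq G]
    (χ : Fˣ →* Multiplicative G)
    (hχ : ∀ g : G, (Finset.univ.filter fun y : Fˣ => (χ y).toAdd = g).card * Fintype.card G =
      Fintype.card F - 1)
    {i i' : F} (hi : i ≠ i') (u v : G) :
    (Finset.univ.filter fun r : Option F × G × G =>
      conferenceArray χ r i = u ∧ conferenceArray χ r i' = v).card = Fintype.card F + 1 := by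
  have hrow : ∀ x : Option F, (Finset.univ.filter fun ab : G × G =>
      conferenceArray χ (x, ab) i = u ∧ conferenceArray χ (x, ab) i' = v).card =
      (if x = some i then 1 else 0) + (if x = some i' then 1 else 0) +
      (if (x ≠ some i ∧ x ≠ some i') ∧
        conferenceMatrix χ x i - conferenceMatrix χ x i' = u - v then 1 else 0) *
        Fintype.card G := by
    intro x
    by_cases hx : x = some i
    · have hxi : x ≠ some i' := by rw [hx]; simpa using hi
      have : (Finset.univ.filter fun ab : G × G =>
          conferenceArray χ (x, ab) i = u ∧ conferenceArray χ (x, ab) i' = v) =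
          {(v - conferenceMatrix χ x i', u)} := by
        ext ⟨a, b⟩
        simp only [conferenceArray, if_pos hx, if_neg hxi, Finset.mem_filter, Finset.mem_univ,
          true_and, Finset.mem_singleton, Prod.mk.injEq, eq_sub_iff_add_eq]
        exact and_comm
      rw [this]; simp [hx, hi]
    by_cases hx' : x = some i'
    · have : (Finset.univ.filter fun ab : G × G =>
          conferenceArray χ (x, ab) i = u ∧ conferenceArray χ (x, ab) i' = v) =
          {(u - conferenceMatrix χ x i, v)} := by
        ext ⟨a, b⟩
        simp only [conferenceArray, if_pos hx', if_neg hx, Finset.mem_filter, Finset.mem_univ,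
          true_and, Finset.mem_singleton, Prod.mk.injEq, eq_sub_iff_add_eq]
      rw [this]; simp [hx', hi.symm]
    by_cases h : conferenceMatrix χ x i - conferenceMatrix χ x i' = u - v
    · have : (Finset.univ.filter fun ab : G × G =>
          conferenceArray χ (x, ab) i = u ∧ conferenceArray χ (x, ab) i' = v) =
          {u - conferenceMatrix χ x i} ×ˢ Finset.univ := by
        ext ⟨a, b⟩
        simp only [conferenceArray, if_neg hx, if_neg hx', Finset.mem_filter, Finset.mem_univ,
          true_and, Finset.mem_product, Finset.mem_singleton, and_true, eq_sub_iff_add_eq]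
        refine ⟨fun h' => h'.1, fun h' => ⟨h', ?_⟩⟩
        rw [← sub_eq_zero] at h h' ⊢
        rw [← sub_eq_zero.2 (h'.trans h.symm)]
        abel
      rw [this, Finset.card_product]; simp [hx, hx', h]
    · have : (Finset.univ.filter fun ab : G × G =>
          conferenceArray χ (x, ab) i = u ∧ conferenceArray χ (x, ab) i' = v) = ∅ := by
        ext ⟨a, b⟩
        simp only [conferenceArray, if_neg hx, if_neg hx', Finset.mem_filter, Finset.mem_univ,
          true_and, Finset.notMem_empty, iff_false]
        rintro ⟨rfl, rfl⟩
        exact h (by abel)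
      rw [this]; simp [hx, hx', h]
  have hF : 1 ≤ Fintype.card F := Fintype.card_pos
  rw [Finset.card_filter, Fintype.sum_prod_type]
  simp_rw [← Finset.card_filter, hrow]
  rw [Finset.sum_add_distrib, Finset.sum_add_distrib, ← Finset.sum_mul,
    ← Finset.card_filter (fun x : Option F => (x ≠ some i ∧ x ≠ some i') ∧ _),
    card_conferenceMatrix_sub χ hi, hχ]
  simp only [Finset.sum_ite_eq', Finset.mem_univ, if_true]
  omega

end ConferenceArray

/-- The rows of the array `M` are uniformly distributed on the columns in `S`.  An orthogonal array
of strength `k` has this property for all `S` with `k` elements; for fewer than `k` columns in total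
that says nothing about smaller sets `S`, for which the property is needed as well. -/
def IsUniformOn {N n : ℕ} {α : Type*} [Fintype α] [DecidableEq α]
    (M : Fin N → Fin n → α) (S : Finset (Fin n)) : Prop :=
  ∀ v : S → α,
    (Finset.univ.filter fun j : Fin N => ∀ i : S, M j i = v i).card * Fintype.card α ^ S.card = N

/-- Arrays with `n` columns, `N = O(n)` rows and uniformly distributed pairs of columns, over any
alphabet of size `s`.  For a prime `p` which does not divide `s`, the number `q = p ^ (φ(s) * m)`
is `1` modulo `s`, so that there is a conference array over `ZMod s` with `q` columns.  Consecutive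
numbers of this form have a bounded ratio. -/
theorem exists_linear_array (α : Type*) [Fintype α] [DecidableEq α] [Nonempty α] :
    ∃ K : ℕ, 0 < K ∧ ∀ n : ℕ, 1 ≤ n → ∃ (N : ℕ) (M : Fin N → Fin n → α), 0 < N ∧ N ≤ K * n ∧
      ∀ S : Finset (Fin n), S.card ≤ 2 → IsUniformOn M S := by
  set s := Fintype.card α with hs
  have hs0 : 0 < s := Fintype.card_pos
  have : NeZero s := ⟨hs0.ne'⟩
  obtain ⟨p, hsp, hp⟩ := Nat.exists_infinite_primes (s + 1)
  have : Fact p.Prime := ⟨hp⟩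
  have hcop : p.Coprime s := (Nat.Prime.coprime_iff_not_dvd hp).2 fun h =>
    absurd (Nat.le_of_dvd hs0 h) (by omega)
  have hφ : 0 < s.totient := Nat.totient_pos.2 hs0
  set Q := p ^ s.totient with hQ
  have hQ1 : 1 < Q := Nat.one_lt_pow hφ.ne' hp.one_lt
  refine ⟨(Q + 1) * s ^ 2, by positivity, fun n hn => ?_⟩
  -- The least power `q = Q ^ m` above `n` satisfies `q ≤ Q n`, and `m ≠ 0`.
  set m := Nat.log Q n + 1 with hm
  have hq : n ≤ Q ^ m := (Nat.lt_pow_succ_log_self hQ1 n).le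
  have hq' : Q ^ m ≤ Q * n := by
    rw [hm, pow_succ, mul_comm]
    exact Nat.mul_le_mul_left _ (Nat.pow_log_le_self Q (by omega))
  let F := GaloisField p (s.totient * m)
  have hexp : s.totient * m ≠ 0 := Nat.mul_ne_zero hφ.ne' (by omega)
  have : Finite F := inferInstance
  let : Fintype F := Fintype.ofFinite F
  let : DecidableEq F := Classical.decEq F
  have hF : Fintype.card F = Q ^ m := by
    rw [← Nat.card_eq_fintype_card, GaloisField.card p _ hexp, pow_mul]
  have hdvd : s ∣ Fintype.card F - 1 := by
    rw [hF]
    have : Q ^ m ≡ 1 ^ m [MOD s] := (Nat.ModEq.pow_totient hcop).pow m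
    rw [one_pow] at this
    exact (Nat.modEq_iff_dvd' (Nat.one_le_pow _ _ (by omega))).1 this.symm
  obtain ⟨χ, hχ⟩ := exists_monoidHom_zmod_card_fiber F s hdvd
  have hcG : Fintype.card (ZMod s) = s := ZMod.card s
  let eα : ZMod s ≃ α := Fintype.equivOfCardEq hcG
  let R := Option F × ZMod s × ZMod s
  have hR : Fintype.card R = (Q ^ m + 1) * s ^ 2 := by
    simp only [R, Fintype.card_prod, Fintype.card_option, hcG, hF]; ring
  let eR : Fin ((Q ^ m + 1) * s ^ 2) ≃ R := Fintype.equivOfCardEq (by simp [hR])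
  obtain ⟨c⟩ : Nonempty (Fin n ↪ F) :=
    Function.Embedding.nonempty_of_card_le (by simpa [hF] using hq)
  refine ⟨(Q ^ m + 1) * s ^ 2, fun j i => eα (conferenceArray χ (eR j) (c i)), by positivity, ?_,
    fun S hS v => ?_⟩
  · calc (Q ^ m + 1) * s ^ 2 ≤ (Q * n + n) * s ^ 2 := by gcongr
      _ = (Q + 1) * s ^ 2 * n := by ring
  · have htr : (Finset.univ.filter fun j : Fin ((Q ^ m + 1) * s ^ 2) =>
        ∀ i : S, eα (conferenceArray χ (eR j) (c i)) = v i).card =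
        (Finset.univ.filter fun r : R => ∀ i : S, conferenceArray χ r (c i) = eα.symm (v i)).card := by
      refine Finset.card_equiv eR fun j => ?_
      simp [Equiv.eq_symm_apply]
    rw [htr]
    obtain h0 | h1 | h2 : S.card = 0 ∨ S.card = 1 ∨ S.card = 2 := by omega
    · have hS0 : S = ∅ := Finset.card_eq_zero.1 h0
      subst hS0
      simp [hR]
    · obtain ⟨i, rfl⟩ := Finset.card_eq_one.1 h1
      have := card_conferenceArray_eq χ (c i) (eα.symm (v ⟨i, by simp⟩))
      have hcongr : (Finset.univ.filter fun r : R =>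
          ∀ k : ({i} : Finset (Fin n)), conferenceArray χ r (c k) = eα.symm (v k)) =
          Finset.univ.filter fun r : R =>
            conferenceArray χ r (c i) = eα.symm (v ⟨i, by simp⟩) := by
        refine Finset.filter_congr fun r _ => ⟨fun h => h ⟨i, by simp⟩, ?_⟩
        rintro h ⟨k, hk⟩
        obtain rfl := Finset.mem_singleton.1 hk
        exact h
      rw [hcongr, this, hcG, hF, Finset.card_singleton]; ring
    · obtain ⟨i, i', hii, rfl⟩ := Finset.card_eq_two.1 h2
      have := card_conferenceArray_eq_and χ (by rw [hcG]; exact hχ) (c.injective.ne hii)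
        (eα.symm (v ⟨i, by simp⟩)) (eα.symm (v ⟨i', by simp⟩))
      have hcongr : (Finset.univ.filter fun r : R =>
          ∀ k : ({i, i'} : Finset (Fin n)), conferenceArray χ r (c k) = eα.symm (v k)) =
          Finset.univ.filter fun r : R => conferenceArray χ r (c i) = eα.symm (v ⟨i, by simp⟩) ∧
            conferenceArray χ r (c i') = eα.symm (v ⟨i', by simp⟩) := by
        refine Finset.filter_congr fun r _ => ⟨fun h => ⟨h ⟨i, by simp⟩, h ⟨i', by simp⟩⟩, ?_⟩
        rintro ⟨h, h'⟩ ⟨k, hk⟩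
        obtain rfl | hk := Finset.mem_insert.1 hk
        · exact h
        · obtain rfl := Finset.mem_singleton.1 hk
          exact h'
      rw [hcongr, this, hF, h2]

/-! ### Errors of product formulas in a Banach algebra -/

section Trotter

variable {𝔸 : Type*} [NormedRing 𝔸]

theorem norm_list_sum_le (L : List 𝔸) : ‖L.sum‖ ≤ (L.map norm).sum := by
  induction L with
  | nil => simp
  | cons A L ih => simpa using (norm_add_le _ _).trans (by gcongr)

theorem sum_map_norm_nonneg (L : List 𝔸) : 0 ≤ (L.map norm).sum :=
  (norm_nonneg _).trans (norm_list_sum_le L)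

/-- Errors of contractions grow at most linearly under taking powers. -/
theorem norm_pow_sub_pow_le [NormOneClass 𝔸] {U V : 𝔸} (hU : ‖U‖ ≤ 1) (hV : ‖V‖ ≤ 1) (r : ℕ) :
    ‖U ^ r - V ^ r‖ ≤ r * ‖U - V‖ := by
  induction r with
  | zero => simp
  | succ r ih =>
    have key : U ^ (r + 1) - V ^ (r + 1) = U ^ r * (U - V) + (U ^ r - V ^ r) * V := by
      rw [pow_succ, pow_succ]; noncomm_ring
    have hUr : ‖U ^ r‖ ≤ 1 := (norm_pow_le U r).trans (pow_le_one₀ (norm_nonneg _) hU)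
    rw [key]
    calc _ ≤ ‖U ^ r‖ * ‖U - V‖ + ‖U ^ r - V ^ r‖ * ‖V‖ :=
          (norm_add_le _ _).trans (by gcongr <;> exact norm_mul_le _ _)
      _ ≤ 1 * ‖U - V‖ + r * ‖U - V‖ * 1 := by gcongr
      _ = _ := by push_cast; ring

variable [NormedAlgebra ℂ 𝔸]

/-- The part of degree two in the expansion of a product of exponentials. -/
noncomputable def quadraticPart : List 𝔸 → 𝔸
  | [] => 0
  | A :: L => (2⁻¹ : ℂ) • A ^ 2 + A * L.sum + quadraticPart L

theorem norm_quadraticPart_le [NormOneClass 𝔸] (L : List 𝔸) :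
    ‖quadraticPart L‖ ≤ (L.map norm).sum ^ 2 / 2 := by
  induction L with
  | nil => simp [quadraticPart]
  | cons A L ih =>
    simp only [quadraticPart, List.map_cons, List.sum_cons]
    refine (norm_add₃_le).trans ?_
    have h1 : ‖(2⁻¹ : ℂ) • A ^ 2‖ ≤ ‖A‖ ^ 2 / 2 := by
      rw [norm_smul, norm_inv, div_eq_inv_mul]
      gcongr
      · simp
      · exact norm_pow_le A 2
    have h2 : ‖A * L.sum‖ ≤ ‖A‖ * (L.map norm).sum :=
      (norm_mul_le _ _).trans (by gcongr; exact norm_list_sum_le L)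
    nlinarith

theorem quadraticPart_append (L L' : List 𝔸) :
    quadraticPart (L ++ L') = quadraticPart L + L.sum * L'.sum + quadraticPart L' := by
  induction L with
  | nil => simp [quadraticPart]
  | cons A L ih =>
    simp only [List.cons_append, quadraticPart, ih, List.sum_append, List.sum_cons]
    noncomm_ring

theorem quadraticPart_add_quadraticPart_reverse (L : List 𝔸) :
    quadraticPart L + quadraticPart L.reverse = L.sum ^ 2 := by
  induction L with
  | nil => simp [quadraticPart]
  | cons A L ih =>
    have h : quadraticPart [A] = (2⁻¹ : ℂ) • A ^ 2 := by simp [quadraticPart]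
    have h2 : (2⁻¹ : ℂ) • A ^ 2 + (2⁻¹ : ℂ) • A ^ 2 = A ^ 2 := by
      rw [← add_smul]; norm_num
    rw [List.reverse_cons, quadraticPart_append, h, quadraticPart, List.sum_reverse,
      List.sum_cons, List.sum_cons, List.sum_nil, add_zero]
    calc _ = (quadraticPart L + quadraticPart L.reverse) +
          ((2⁻¹ : ℂ) • A ^ 2 + (2⁻¹ : ℂ) • A ^ 2) + A * L.sum + L.sum * A := by abel
      _ = _ := by rw [ih, h2]; noncomm_ring

/-- A symmetric product of exponentials agrees with the exponential of the sum up to second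
order. -/
theorem quadraticPart_of_reverse_eq {L : List 𝔸} (hL : L.reverse = L) :
    quadraticPart L = (2⁻¹ : ℂ) • L.sum ^ 2 := by
  have h := quadraticPart_add_quadraticPart_reverse L
  rw [hL] at h
  rw [← h, ← two_smul ℂ, smul_smul]
  norm_num

variable [NormOneClass 𝔸] [CompleteSpace 𝔸]

open NormedSpace in
/-- The remainder of the exponential series in a Banach algebra is bounded by the one for the
norm. -/
theorem norm_exp_sub_sum_le (x : 𝔸) (m : ℕ) :
    ‖exp x - ∑ k ∈ Finset.range m, ((k.factorial : ℂ)⁻¹) • x ^ k‖ ≤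
      Real.exp ‖x‖ - ∑ k ∈ Finset.range m, ‖x‖ ^ k / k.factorial := by
  have h1 := exp_series_hasSum_exp' (𝕂 := ℂ) x
  have h2 : HasSum (fun k : ℕ => ‖x‖ ^ k / k.factorial) (Real.exp ‖x‖) := by
    rw [Real.exp_eq_exp_ℝ]; exact expSeries_div_hasSum_exp ‖x‖
  refine HasSum.norm_le_of_bounded ((hasSum_nat_add_iff' m).2 h1) ((hasSum_nat_add_iff' m).2 h2)
    fun k => ?_
  rw [norm_smul, norm_inv, Complex.norm_natCast, div_eq_inv_mul]
  gcongr
  exact norm_pow_le x _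

theorem norm_exp_le' (x : 𝔸) : ‖NormedSpace.exp x‖ ≤ Real.exp ‖x‖ := by
  simpa using norm_exp_sub_sum_le x 0

theorem norm_exp_sub_one_le' (x : 𝔸) : ‖NormedSpace.exp x - 1‖ ≤ Real.exp ‖x‖ - 1 := by
  simpa using norm_exp_sub_sum_le x 1

theorem norm_exp_sub_one_sub_le (x : 𝔸) :
    ‖NormedSpace.exp x - 1 - x‖ ≤ Real.exp ‖x‖ - 1 - ‖x‖ := by
  simpa [Finset.sum_range_succ, ← sub_sub] using norm_exp_sub_sum_le x 2

theorem norm_exp_sub_one_sub_sub_le (x : 𝔸) :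
    ‖NormedSpace.exp x - 1 - x - (2⁻¹ : ℂ) • x ^ 2‖ ≤
      Real.exp ‖x‖ - 1 - ‖x‖ - ‖x‖ ^ 2 / 2 := by
  simpa [Finset.sum_range_succ, ← sub_sub] using norm_exp_sub_sum_le x 3

/-- The remainder of first order of a product of exponentials is bounded by the one for the
norms. -/
theorem norm_prod_exp_sub_one_sub_le (L : List 𝔸) :
    ‖(L.map NormedSpace.exp).prod - 1 - L.sum‖ ≤
      Real.exp (L.map norm).sum - 1 - (L.map norm).sum := by
  induction L with
  | nil => simp
  | cons A L ih =>
    simp only [List.map_cons, List.prod_cons, List.sum_cons]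
    set P := (L.map NormedSpace.exp).prod
    set b := (L.map norm).sum
    have hB : ‖L.sum‖ ≤ b := norm_list_sum_le L
    -- The same identity holds for the scalar remainders, with the norms in place of `A` and `L`.
    have h0 : 0 ≤ Real.exp ‖A‖ - 1 := (norm_nonneg _).trans (norm_exp_sub_one_le' A)
    have key : NormedSpace.exp A * P - 1 - (A + L.sum) =
        NormedSpace.exp A * (P - 1 - L.sum) + (NormedSpace.exp A - 1 - A) +
          (NormedSpace.exp A - 1) * L.sum := by noncomm_ring
    rw [key, Real.exp_add]
    calc _ ≤ ‖NormedSpace.exp A‖ * ‖P - 1 - L.sum‖ + ‖NormedSpace.exp A - 1 - A‖ +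
          ‖NormedSpace.exp A - 1‖ * ‖L.sum‖ := by
            refine (norm_add₃_le).trans ?_
            gcongr <;> exact norm_mul_le _ _
      _ ≤ Real.exp ‖A‖ * (Real.exp b - 1 - b) + (Real.exp ‖A‖ - 1 - ‖A‖) +
          (Real.exp ‖A‖ - 1) * b := by
            gcongr
            · exact norm_exp_le' A
            · exact norm_exp_sub_one_sub_le A
            · exact norm_exp_sub_one_le' A
      _ = _ := by ring

/-- The remainder of second order of a product of exponentials is bounded by the one for the
norms. -/
theorem norm_prod_exp_sub_one_sub_sub_le (L : List 𝔸) :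
    ‖(L.map NormedSpace.exp).prod - 1 - L.sum - quadraticPart L‖ ≤
      Real.exp (L.map norm).sum - 1 - (L.map norm).sum - (L.map norm).sum ^ 2 / 2 := by
  induction L with
  | nil => simp [quadraticPart]
  | cons A L ih =>
    simp only [List.map_cons, List.prod_cons, List.sum_cons, quadraticPart]
    set P := (L.map NormedSpace.exp).prod
    set b := (L.map norm).sum
    set Q := quadraticPart L
    have hB : ‖L.sum‖ ≤ b := norm_list_sum_le L
    have hQ : ‖Q‖ ≤ b ^ 2 / 2 := norm_quadraticPart_le L
    have h0 : 0 ≤ Real.exp ‖A‖ - 1 := (norm_nonneg _).trans (norm_exp_sub_one_le' A)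
    have h0' : 0 ≤ Real.exp ‖A‖ - 1 - ‖A‖ := (norm_nonneg _).trans (norm_exp_sub_one_sub_le A)
    have key : NormedSpace.exp A * P - 1 - (A + L.sum) -
          ((2⁻¹ : ℂ) • A ^ 2 + A * L.sum + Q) =
        NormedSpace.exp A * (P - 1 - L.sum - Q) +
          (NormedSpace.exp A - 1 - A - (2⁻¹ : ℂ) • A ^ 2) +
          (NormedSpace.exp A - 1 - A) * L.sum + (NormedSpace.exp A - 1) * Q := by
      noncomm_ring
    rw [key, Real.exp_add]
    calc _ ≤ ‖NormedSpace.exp A‖ * ‖P - 1 - L.sum - Q‖ +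
          ‖NormedSpace.exp A - 1 - A - (2⁻¹ : ℂ) • A ^ 2‖ +
          ‖NormedSpace.exp A - 1 - A‖ * ‖L.sum‖ + ‖NormedSpace.exp A - 1‖ * ‖Q‖ := by
            refine (norm_add₄_le).trans ?_
            gcongr <;> exact norm_mul_le _ _
      _ ≤ Real.exp ‖A‖ * (Real.exp b - 1 - b - b ^ 2 / 2) +
          (Real.exp ‖A‖ - 1 - ‖A‖ - ‖A‖ ^ 2 / 2) + (Real.exp ‖A‖ - 1 - ‖A‖) * b +
          (Real.exp ‖A‖ - 1) * (b ^ 2 / 2) := by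
            gcongr
            · exact norm_exp_le' A
            · exact norm_exp_sub_one_sub_sub_le A
            · exact norm_exp_sub_one_sub_le A
            · exact norm_exp_sub_one_le' A
      _ = _ := by ring

/-- Error of a product formula of first order whose factors are contractions. -/
theorem norm_prod_exp_sub_exp_sum_le (L : List 𝔸) (h1 : ‖(L.map NormedSpace.exp).prod‖ ≤ 1)
    (h2 : ‖NormedSpace.exp L.sum‖ ≤ 1) :
    ‖(L.map NormedSpace.exp).prod - NormedSpace.exp L.sum‖ ≤ 2 * (L.map norm).sum ^ 2 := by
  set a := (L.map norm).sum
  have ha0 : 0 ≤ a := sum_map_norm_nonneg L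
  -- For `a ≥ 1` the bound is trivial, as the two contractions differ by at most `2`.
  rcases le_total 1 a with ha | ha
  · refine (norm_sub_le _ _).trans ?_
    nlinarith
  · have hexp : ∀ x : ℝ, 0 ≤ x → x ≤ 1 → Real.exp x - 1 - x ≤ x ^ 2 := by
      intro x hx hx1
      have := Real.abs_exp_sub_one_sub_id_le (x := x) (by rwa [abs_of_nonneg hx])
      exact (le_abs_self _).trans this
    have hS : ‖L.sum‖ ≤ a := norm_list_sum_le L
    have e1 := (norm_prod_exp_sub_one_sub_le L).trans (hexp a ha0 ha)
    have e2 := (norm_exp_sub_one_sub_le L.sum).trans (hexp _ (norm_nonneg _) (hS.trans ha))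
    have e3 : ‖L.sum‖ ^ 2 ≤ a ^ 2 := by gcongr
    have key : (L.map NormedSpace.exp).prod - NormedSpace.exp L.sum =
        ((L.map NormedSpace.exp).prod - 1 - L.sum) - (NormedSpace.exp L.sum - 1 - L.sum) := by
      abel
    rw [key]
    refine (norm_sub_le _ _).trans ?_
    linarith

/-- Error of a symmetric product formula whose factors are contractions. -/
theorem norm_prod_exp_sub_exp_sum_le_of_reverse_eq {L : List 𝔸} (hL : L.reverse = L)
    (h1 : ‖(L.map NormedSpace.exp).prod‖ ≤ 1) (h2 : ‖NormedSpace.exp L.sum‖ ≤ 1) :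
    ‖(L.map NormedSpace.exp).prod - NormedSpace.exp L.sum‖ ≤ 2 * (L.map norm).sum ^ 3 := by
  set a := (L.map norm).sum
  have ha0 : 0 ≤ a := sum_map_norm_nonneg L
  -- For `a ≥ 1` the bound is trivial, as the two contractions differ by at most `2`.
  rcases le_total 1 a with ha | ha
  · refine (norm_sub_le _ _).trans ?_
    have : 1 ≤ a ^ 3 := one_le_pow₀ ha
    linarith
  · have hexp : ∀ x : ℝ, 0 ≤ x → x ≤ 1 → Real.exp x - 1 - x - x ^ 2 / 2 ≤ x ^ 3 := by
      intro x hx hx1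
      have := (le_abs_self _).trans
        (Real.exp_bound (x := x) (by rwa [abs_of_nonneg hx]) (n := 3) (by norm_num))
      rw [abs_of_nonneg hx] at this
      norm_num [Finset.sum_range_succ, Nat.factorial] at this
      have hx3 : 0 ≤ x ^ 3 := by positivity
      linarith
    have hS : ‖L.sum‖ ≤ a := norm_list_sum_le L
    have e1 := (norm_prod_exp_sub_one_sub_sub_le L).trans (hexp a ha0 ha)
    have e2 := (norm_exp_sub_one_sub_sub_le L.sum).trans (hexp _ (norm_nonneg _) (hS.trans ha))
    have e3 : ‖L.sum‖ ^ 3 ≤ a ^ 3 := by gcongr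
    rw [quadraticPart_of_reverse_eq hL] at e1
    have key : (L.map NormedSpace.exp).prod - NormedSpace.exp L.sum =
        ((L.map NormedSpace.exp).prod - 1 - L.sum - (2⁻¹ : ℂ) • L.sum ^ 2) -
          (NormedSpace.exp L.sum - 1 - L.sum - (2⁻¹ : ℂ) • L.sum ^ 2) := by
      abel
    rw [key]
    refine (norm_sub_le _ _).trans ?_
    linarith

end Trotter

/-! ### Generalized Pauli strings -/

section Pauli

variable {n d : ℕ} [NeZero d]

theorem isPrimitiveRoot_omega : IsPrimitiveRoot (omega d) d :=
  Complex.isPrimitiveRoot_exp d (NeZero.ne d)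

theorem omega_pow_eq_of_modEq {k l : ℕ} (h : k ≡ l [MOD d]) : omega d ^ k = omega d ^ l :=
  pow_eq_pow_of_modEq h isPrimitiveRoot_omega.pow_eq_one

theorem omega_pow_mul_star (k : ℕ) : omega d ^ k * star (omega d ^ k) = 1 := by
  have h : ‖omega d ^ k‖ = 1 := by
    rw [norm_pow, isPrimitiveRoot_omega.norm'_eq_one (NeZero.ne d), one_pow]
  rw [Complex.star_def, Complex.mul_conj, Complex.normSq_eq_norm_sq, h]
  simp

theorem shiftX_pow_apply (a : ℕ) (y x : Fin d) :
    (shiftX d ^ a) y x = if (y : ℕ) = ((x : ℕ) + a) % d then 1 else 0 := by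
  induction a generalizing x with
  | zero => simp [Matrix.one_apply, Fin.ext_iff, Nat.mod_eq_of_lt x.isLt]
  | succ a ih =>
    have hx : ((x : ℕ) + 1) % d < d := Nat.mod_lt _ (NeZero.pos d)
    rw [pow_succ, Matrix.mul_apply, Finset.sum_eq_single ⟨((x : ℕ) + 1) % d, hx⟩]
    · rw [ih]
      simp only [shiftX, Matrix.of_apply, if_true, mul_one, Nat.mod_add_mod]
      rw [add_assoc, add_comm 1 a]
    · intro z _ hz
      have : ¬ (z : ℕ) = ((x : ℕ) + 1) % d := fun h => hz (Fin.ext h)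
      simp [shiftX, this]
    · simp

/-- The generalized Pauli matrix `X^a Z^b` maps `|x⟩` to `ω^(b x) |x + a⟩`. -/
theorem pauli_apply (p : Fin d × Fin d) (y x : Fin d) :
    pauli d p y x = if y = x + p.1 then omega d ^ ((p.2 : ℕ) * (x : ℕ)) else 0 := by
  rw [pauli, clockZ, Matrix.diagonal_pow, Matrix.mul_diagonal, shiftX_pow_apply]
  simp only [Fin.ext_iff, Fin.val_add, Pi.pow_apply, ← pow_mul, mul_comm (x : ℕ), ite_mul,
    one_mul, zero_mul]

/-- The phase `ω^(∑ bᵢ xᵢ)`, by which `Z^{b₁} ⊗ ⋯ ⊗ Z^{bₙ}` acts on the basis state `|x⟩`. -/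
noncomputable def phase (b x : Fin n → Fin d) : ℂ := ∏ i, omega d ^ ((b i : ℕ) * (x i : ℕ))

theorem phase_mul_star (b x : Fin n → Fin d) : phase b x * star (phase b x) = 1 := by
  simp only [phase, star_prod, ← Finset.prod_mul_distrib, omega_pow_mul_star, Finset.prod_const_one]

theorem pauliString_apply (m : Fin n → Fin d × Fin d) (x y : Fin n → Fin d) :
    pauliString m x y =
      if x = y + (fun i => (m i).1) then phase (fun i => (m i).2) y else 0 := by
  simp only [pauliString, Matrix.of_apply, pauli_apply, phase]
  split_ifs with h
  · exact Finset.prod_congr rfl fun i _ => if_pos (congrFun h i)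
  · obtain ⟨i, hi⟩ := Function.ne_iff.1 h
    exact Finset.prod_eq_zero (Finset.mem_univ i) (if_neg hi)

/-- Conjugation by a generalized Pauli string, in coordinates. -/
theorem pauliString_conj_apply (m : Fin n → Fin d × Fin d) (h : Op n d) (x y : Fin n → Fin d) :
    (pauliString m * h * (pauliString m).conjTranspose) x y =
      phase (fun i => (m i).2) (x - fun i => (m i).1) *
        star (phase (fun i => (m i).2) (y - fun i => (m i).1)) *
        h (x - fun i => (m i).1) (y - fun i => (m i).1) := by
  rw [Matrix.mul_apply, Finset.sum_eq_single (y - fun i => (m i).1)]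
  · rw [Matrix.mul_apply, Finset.sum_eq_single (x - fun i => (m i).1)]
    · simp [pauliString_apply]; ring
    · intro z _ hz
      have : ¬ x = z + fun i => (m i).1 := fun h => hz (eq_sub_of_add_eq h.symm)
      simp [pauliString_apply, this]
    · simp
  · intro z _ hz
    have : ¬ y = z + fun i => (m i).1 := fun h => hz (eq_sub_of_add_eq h.symm)
    simp [pauliString_apply, this]
  · simp

theorem pauliString_mem_unitaryGroup (m : Fin n → Fin d × Fin d) :
    pauliString m ∈ Matrix.unitaryGroup (Fin n → Fin d) ℂ := by
  rw [Matrix.mem_unitaryGroup_iff, Matrix.star_eq_conjTranspose]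
  ext x y
  have := pauliString_conj_apply m 1 x y
  rw [mul_one] at this
  rw [this, Matrix.one_apply, Matrix.one_apply]
  by_cases hxy : x = y
  · subst hxy; rw [phase_mul_star, if_pos rfl, if_pos rfl, mul_one]
  · rw [if_neg (fun h => hxy (sub_left_injective h)), if_neg hxy, mul_zero]

/-- The adjoint of a generalized Pauli string is a generalized Pauli string, up to a power
of `ω`. -/
theorem exists_pauliString_conjTranspose (m : Fin n → Fin d × Fin d) :
    ∃ (c : Fin d) (m' : Fin n → Fin d × Fin d),
      (pauliString m).conjTranspose = omega d ^ (c : ℕ) • pauliString m' := by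
  refine ⟨⟨(∑ i, ((m i).2 : ℕ) * ((m i).1 : ℕ)) % d, Nat.mod_lt _ (NeZero.pos d)⟩,
    fun i => (-(m i).1, -(m i).2), ?_⟩
  ext x y
  simp only [Matrix.conjTranspose_apply, Matrix.smul_apply, smul_eq_mul, pauliString_apply]
  rw [omega_pow_eq_of_modEq (Nat.mod_modEq _ _)]
  by_cases h : y = x + fun i => (m i).1
  · have h' : x = y + fun i => -(m i).1 := by
      rw [h]; funext i; simp
    rw [if_pos h, if_pos h']
    simp only [phase, star_prod, ← Finset.prod_pow_eq_pow_sum, ← Finset.prod_mul_distrib]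
    refine Finset.prod_congr rfl fun i _ => ?_
    set a := (m i).1
    set b := (m i).2
    have hyi : y i = x i + a := congrFun h i
    have e1 : omega d ^ ((b : ℕ) * (x i : ℕ)) * omega d ^ ((b : ℕ) * (a : ℕ)) =
        omega d ^ ((b : ℕ) * (y i : ℕ)) := by
      rw [← pow_add, ← mul_add, hyi, Fin.val_add]
      exact omega_pow_eq_of_modEq ((Nat.mod_modEq _ _).symm.mul_left _)
    have e2 : omega d ^ ((b : ℕ) * (y i : ℕ)) * omega d ^ (((-b : Fin d) : ℕ) * (y i : ℕ)) = 1 := by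
      rw [← pow_add, ← add_mul, pow_mul]
      have : omega d ^ ((b : ℕ) + ((-b : Fin d) : ℕ)) = 1 := by
        have hb : (((b + -b : Fin d)) : ℕ) = 0 := by simp
        rw [Fin.val_add] at hb
        exact isPrimitiveRoot_omega.pow_eq_one_iff_dvd _ |>.2 (Nat.dvd_of_mod_eq_zero hb)
      rw [this, one_pow]
    calc star (omega d ^ ((b : ℕ) * (x i : ℕ)))
        = star (omega d ^ ((b : ℕ) * (x i : ℕ))) * (omega d ^ ((b : ℕ) * (y i : ℕ)) *
            omega d ^ (((-b : Fin d) : ℕ) * (y i : ℕ))) := by rw [e2, mul_one]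
      _ = (omega d ^ ((b : ℕ) * (x i : ℕ)) * star (omega d ^ ((b : ℕ) * (x i : ℕ)))) *
            (omega d ^ ((b : ℕ) * (a : ℕ)) *
              omega d ^ (((-b : Fin d) : ℕ) * (y i : ℕ))) := by rw [← e1]; ring
      _ = _ := by rw [omega_pow_mul_star, one_mul]
  · have h' : ¬ x = y + fun i => -(m i).1 := fun h' => h (by rw [h']; funext i; simp)
    rw [if_neg h, if_neg h', star_zero, mul_zero]

/-! ### Twirling with the rows of an orthogonal array -/

/-- Orthogonality of the characters `b ↦ ω^(b z)`. -/
theorem sum_phase_mul_star (x y : Fin n → Fin d) :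
    ∑ b : Fin n → Fin d, phase b x * star (phase b y) = if x = y then (d : ℂ) ^ n else 0 := by
  have hsite : ∀ u v : Fin d, ∑ b : Fin d,
      omega d ^ ((b : ℕ) * (u : ℕ)) * star (omega d ^ ((b : ℕ) * (v : ℕ))) =
      if u = v then (d : ℂ) else 0 := by
    intro u v
    split_ifs with huv
    · subst huv
      simp only [omega_pow_mul_star]
      simp
    · set z := omega d ^ (u : ℕ) * star (omega d ^ (v : ℕ)) with hz
      have hterm : ∀ b : Fin d, omega d ^ ((b : ℕ) * (u : ℕ)) *
          star (omega d ^ ((b : ℕ) * (v : ℕ))) = z ^ (b : ℕ) := by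
        intro b
        rw [hz, mul_pow, ← star_pow, ← pow_mul, ← pow_mul, mul_comm (b : ℕ), mul_comm (b : ℕ)]
      simp_rw [hterm]
      rw [Fin.sum_univ_eq_sum_range (fun k => z ^ k)]
      have hz1 : z ≠ 1 := by
        intro h
        refine huv (Fin.ext (isPrimitiveRoot_omega.pow_inj u.isLt v.isLt ?_))
        calc omega d ^ (u : ℕ) = omega d ^ (u : ℕ) *
              (omega d ^ (v : ℕ) * star (omega d ^ (v : ℕ))) := by
                rw [omega_pow_mul_star, mul_one]
          _ = z * omega d ^ (v : ℕ) := by rw [hz]; ring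
          _ = _ := by rw [h, one_mul]
      have hzd : z ^ d = 1 := by
        rw [hz, mul_pow, ← star_pow, ← pow_mul, ← pow_mul, mul_comm (u : ℕ), mul_comm (v : ℕ),
          pow_mul, pow_mul, isPrimitiveRoot_omega.pow_eq_one]
        simp
      rw [geom_sum_eq hz1, hzd, sub_self, zero_div]
  simp only [phase, star_prod, ← Finset.prod_mul_distrib]
  rw [← Fintype.prod_sum (fun (i : Fin n) (b : Fin d) => omega d ^ ((b : ℕ) * (x i : ℕ)) *
    star (omega d ^ ((b : ℕ) * (y i : ℕ))))]
  simp_rw [hsite]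
  split_ifs with h
  · subst h; simp
  · obtain ⟨i, hi⟩ := Function.ne_iff.1 h
    exact Finset.prod_eq_zero (Finset.mem_univ i) (if_neg hi)

/-- Twirling with all generalized Pauli strings kills the operators of trace zero. -/
theorem sum_pauliString_conj_eq_zero {h : Op n d} (hh : h.trace = 0) :
    ∑ m : Fin n → Fin d × Fin d, pauliString m * h * (pauliString m).conjTranspose = 0 := by
  ext x y
  rw [Matrix.sum_apply]
  simp_rw [pauliString_conj_apply]
  -- Split the string `m` into its `X`-exponents `a` and `Z`-exponents `b`, and sum over `b` first.
  rw [← (Equiv.arrowProdEquivProdArrow (Fin n) (fun _ => Fin d) (fun _ => Fin d)).symm.sum_comp,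
    Fintype.sum_prod_type]
  simp only [Equiv.arrowProdEquivProdArrow, Equiv.coe_fn_symm_mk]
  simp_rw [← Finset.sum_mul, sum_phase_mul_star]
  by_cases hxy : x = y
  · subst hxy
    simp only [if_true, ← Finset.mul_sum]
    have : ∑ a : Fin n → Fin d, h (x - a) (x - a) = h.trace := by
      rw [Matrix.trace, ← (Equiv.subLeft x).sum_comp]
      simp
    simp only [Matrix.zero_apply]
    rw [this]
    rw [hh, mul_zero]
  · refine Finset.sum_eq_zero fun a _ => ?_
    rw [if_neg (fun h => hxy (sub_left_injective h)), zero_mul]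

/-- If an operator acts only on the qudits in `S`, then so does its conjugate by a generalized
Pauli string, and the latter depends only on the part of the string on `S`. -/
theorem pauliString_conj_congr {S : Finset (Fin n)} {h : Op n d} (hh : ActsOnlyOn S h)
    {m m' : Fin n → Fin d × Fin d} (hm : ∀ i ∈ S, m i = m' i) :
    pauliString m * h * (pauliString m).conjTranspose =
      pauliString m' * h * (pauliString m').conjTranspose := by
  obtain ⟨B, rfl⟩ := hh
  ext x y
  rw [pauliString_conj_apply, pauliString_conj_apply]
  simp only [embed, Matrix.of_apply, Pi.sub_apply, sub_left_inj]
  split_ifs with hxy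
  · have hB : (B (fun i => x i - (m i).1) fun i => y i - (m i).1) =
        B (fun i => x i - (m' i).1) fun i => y i - (m' i).1 := by
      congr 1 <;> funext i <;> rw [hm i i.2]
    rw [hB]
    congr 1
    simp only [phase, star_prod, ← Finset.prod_mul_distrib]
    refine Finset.prod_congr rfl fun i _ => ?_
    by_cases hi : i ∈ S
    · simp only [Pi.sub_apply, hm i hi]
    · simp only [Pi.sub_apply, hxy i hi, omega_pow_mul_star]
  · simp

end Pauli

section Averages

variable {n : ℕ} {α : Type*} [Fintype α] [DecidableEq α] {E : Type*} [AddCommGroup E] [Module ℂ E]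

/-- Sums, over the rows of an array which is uniformly distributed on the columns in `S`, of a
function which depends only on these columns. -/
theorem card_pow_smul_sum_restrict {J : Type*} [Fintype J] (M : J → Fin n → α) {N : ℕ}
    {S : Finset (Fin n)}
    (hM : ∀ v : S → α,
      (Finset.univ.filter fun j : J => ∀ i : S, M j i = v i).card * Fintype.card α ^ S.card = N)
    (g : (S → α) → E) :
    ((Fintype.card α : ℂ) ^ S.card) • ∑ j, g (fun i => M j i) = (N : ℂ) • ∑ v, g v := by
  rw [← Finset.sum_fiberwise_of_maps_to (s := Finset.univ) (t := (Finset.univ : Finset (S → α)))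
    (g := fun j => fun i : S => M j i) (fun _ _ => Finset.mem_univ _), Finset.smul_sum,
    Finset.smul_sum]
  refine Finset.sum_congr rfl fun v _ => ?_
  rw [Finset.sum_congr rfl (g := fun _ => g v) (fun j hj => by rw [(Finset.mem_filter.1 hj).2]),
    Finset.sum_const, ← Nat.cast_smul_eq_nsmul ℂ, smul_smul, ← hM v]
  simp_rw [funext_iff]
  push_cast
  rw [mul_comm]

theorem card_filter_restrict_eq (S : Finset (Fin n)) (v : S → α) :
    (Finset.univ.filter fun m : Fin n → α => ∀ i : S, m i = v i).card *
      Fintype.card α ^ S.card = Fintype.card α ^ n := by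
  have h : (Finset.univ.filter fun m : Fin n → α => ∀ i : S, m i = v i) =
      Fintype.piFinset fun i => if h : i ∈ S then {v ⟨i, h⟩} else Finset.univ := by
    ext m
    simp only [Finset.mem_filter, Finset.mem_univ, true_and, Fintype.mem_piFinset]
    refine ⟨fun h i => ?_, fun h i => ?_⟩
    · by_cases hi : i ∈ S
      · simpa [hi] using h ⟨i, hi⟩
      · simp [hi]
    · simpa using h i
  rw [h, Fintype.card_piFinset, ← Finset.prod_const, ← Finset.prod_filter_mul_prod_filter_not
    Finset.univ (· ∈ S), Finset.prod_congr rfl (g := fun _ => 1), Finset.prod_const_one, one_mul,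
    Finset.prod_congr rfl (g := fun _ => Fintype.card α), mul_comm]
  · rw [Finset.prod_const, Finset.prod_const, ← pow_add]
    congr 1
    have := Finset.card_filter_add_card_filter_not (s := (Finset.univ : Finset (Fin n))) (· ∈ S)
    simpa using this
  · intro i hi
    simp [(Finset.mem_filter.1 hi).2]
  · intro i hi
    simp [(Finset.mem_filter.1 hi).2]

/-- If a function of strings depends only on the coordinates in `S` and its sum over all strings
vanishes, then so does its sum over the rows of an array which is uniformly distributed on `S`. -/
theorem IsUniformOn.sum_eq_zero [Nonempty α] {N : ℕ} {M : Fin N → Fin n → α} {S : Finset (Fin n)}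
    (hM : IsUniformOn M S) {f : (Fin n → α) → E}
    (hf : ∀ m m' : Fin n → α, (∀ i ∈ S, m i = m' i) → f m = f m') (h0 : ∑ m, f m = 0) :
    ∑ j, f (M j) = 0 := by
  obtain ⟨a⟩ := ‹Nonempty α›
  have hcard : (Fintype.card α : ℂ) ≠ 0 := by
    have : Nonempty α := ⟨a⟩
    exact_mod_cast Fintype.card_ne_zero
  -- `f` as a function on `S`; the value `a` outside of `S` is irrelevant.
  let g : (S → α) → E := fun v => f fun i => if h : i ∈ S then v ⟨i, h⟩ else a
  have hg : ∀ m : Fin n → α, f m = g fun i => m i := fun m => hf _ _ fun i hi => by simp [hi]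
  have h1 := card_pow_smul_sum_restrict M hM g
  have h2 := card_pow_smul_sum_restrict (fun m : Fin n → α => m) (card_filter_restrict_eq S) g
  simp_rw [← hg] at h1 h2
  rw [h0, smul_zero, eq_comm, smul_eq_zero] at h2
  have h3 : ∑ v, g v = 0 := h2.resolve_left (by exact_mod_cast pow_ne_zero n hcard)
  rw [h3, smul_zero, smul_eq_zero] at h1
  exact h1.resolve_left (pow_ne_zero _ hcard)

end Averages

/-- Twirling with the rows of an array which is uniform on sets of at most `k` qudits kills the
`k`-local Hamiltonians. -/
theorem sum_pauliString_conj_eq_zero_of_isLocalHamiltonian {n d k N : ℕ} [NeZero d]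
    {M : Fin N → Fin n → Fin d × Fin d}
    (hM : ∀ S : Finset (Fin n), S.card ≤ k → IsUniformOn M S) {H : Op n d}
    (hH : IsLocalHamiltonian k H) :
    ∑ j, pauliString (M j) * H * (pauliString (M j)).conjTranspose = 0 := by
  obtain ⟨h, hh, rfl⟩ := hH
  simp_rw [Finset.mul_sum, Finset.sum_mul]
  rw [Finset.sum_comm]
  refine Finset.sum_eq_zero fun S hS => ?_
  obtain ⟨h1, -, h3⟩ := hh S (Finset.mem_filter.1 hS).2
  exact (hM S (Finset.mem_filter.1 hS).2).sum_eq_zero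
    (f := fun m => pauliString m * h S * (pauliString m).conjTranspose)
    (fun m m' hm => pauliString_conj_congr h1 hm) (sum_pauliString_conj_eq_zero h3)

/-! ### Operators which are block diagonal for the control qubit -/

section BlockDiagonal

variable {n d : ℕ}

/-- The operator `|0⟩⟨0| ⊗ A + |1⟩⟨1| ⊗ B`, as a homomorphism of star algebras in `(A, B)`. -/
noncomputable def controlled : (Op n d × Op n d) →⋆ₐ[ℂ] CtrlOp n d where
  toFun p := Matrix.single (0 : Fin 2) (0 : Fin 2) (1 : ℂ) ⊗ₖ p.1 +
    Matrix.single (1 : Fin 2) (1 : Fin 2) (1 : ℂ) ⊗ₖ p.2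
  map_one' := by
    ext ⟨a, x⟩ ⟨b, y⟩
    fin_cases a <;> fin_cases b <;> simp [Matrix.kroneckerMap_apply, Matrix.one_apply]
  map_mul' p q := by
    simp only [Prod.fst_mul, Prod.snd_mul, Matrix.add_mul, Matrix.mul_add,
      ← Matrix.mul_kronecker_mul]
    simp
  map_zero' := by simp
  map_add' p q := by
    simp only [Prod.fst_add, Prod.snd_add, Matrix.kronecker_add]
    abel
  commutes' c := by
    ext ⟨a, x⟩ ⟨b, y⟩
    fin_cases a <;> fin_cases b <;>
      simp [Matrix.kroneckerMap_apply, Matrix.algebraMap_matrix_apply]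
  map_star' p := by
    ext ⟨a, x⟩ ⟨b, y⟩
    fin_cases a <;> fin_cases b <;>
      simp [Matrix.kroneckerMap_apply, Matrix.star_apply]

theorem controlled_apply (A B : Op n d) :
    controlled (A, B) = Matrix.single (0 : Fin 2) (0 : Fin 2) (1 : ℂ) ⊗ₖ A +
      Matrix.single (1 : Fin 2) (1 : Fin 2) (1 : ℂ) ⊗ₖ B := rfl

theorem lam_eq_controlled (V : Op n d) : lam V = controlled (V, 1) := rfl

theorem ctrl_eq_controlled (U : Op n d) : ctrl U = controlled (1, U) := rfl

theorem one_kronecker_eq_controlled (A : Op n d) :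
    (1 : Matrix (Fin 2) (Fin 2) ℂ) ⊗ₖ A = controlled (A, A) := by
  rw [controlled_apply, ← Matrix.add_kronecker]
  congr 1
  ext a b
  fin_cases a <;> fin_cases b <;> simp

theorem norm_one_kronecker_le (A : Op n d) :
    ‖(1 : Matrix (Fin 2) (Fin 2) ℂ) ⊗ₖ A‖ ≤ ‖A‖ := by
  rw [one_kronecker_eq_controlled]
  refine (NonUnitalStarAlgHom.norm_apply_le
    (controlled : (Op n d × Op n d) →⋆ₐ[ℂ] CtrlOp n d) (A, A)).trans ?_
  simp

theorem exp_controlled (A B : Op n d) :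
    NormedSpace.exp (controlled (A, B)) =
      controlled (NormedSpace.exp A, NormedSpace.exp B) := by
  have hc : Continuous (controlled : (Op n d × Op n d) →⋆ₐ[ℂ] CtrlOp n d) :=
    LinearMap.continuous_of_finiteDimensional
      (controlled : (Op n d × Op n d) →⋆ₐ[ℂ] CtrlOp n d).toAlgHom.toLinearMap
  let : NormedAlgebra ℚ (Op n d) := NormedAlgebra.restrictScalars ℚ ℂ _
  let : NormedAlgebra ℚ (CtrlOp n d) := NormedAlgebra.restrictScalars ℚ ℂ _
  rw [← NormedSpace.map_exp (controlled : (Op n d × Op n d) →⋆ₐ[ℂ] CtrlOp n d) hc]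
  congr 1
  exact Prod.ext (Prod.fst_exp _) (Prod.snd_exp _)

theorem evolution_controlled (A B : Op n d) (τ : ℝ) :
    evolution (controlled (A, B)) τ = controlled (evolution A τ, evolution B τ) := by
  simp only [evolution]
  rw [← map_smul, Prod.smul_mk, exp_controlled]

theorem evolution_zero {ι : Type*} [Fintype ι] [DecidableEq ι] (τ : ℝ) :
    evolution (0 : Matrix ι ι ℂ) τ = 1 := by
  rw [evolution, smul_zero, NormedSpace.exp_zero]

theorem lam_mem_unitaryGroup {V : Op n d} (hV : V ∈ Matrix.unitaryGroup (Fin n → Fin d) ℂ) :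
    lam V ∈ Matrix.unitaryGroup (Fin 2 × (Fin n → Fin d)) ℂ := by
  rw [Matrix.mem_unitaryGroup_iff] at hV ⊢
  rw [lam_eq_controlled, ← map_star, ← map_mul, Prod.star_def, Prod.mk_mul_mk]
  simp [hV, ← Prod.one_eq_mk]

theorem conjTranspose_lam (V : Op n d) : (lam V).conjTranspose = lam V.conjTranspose := by
  rw [← Matrix.star_eq_conjTranspose, lam_eq_controlled, lam_eq_controlled, ← map_star,
    Prod.star_def]
  simp [Matrix.star_eq_conjTranspose]

end BlockDiagonal

/-! ### Time evolutions -/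

theorem evolution_mem_unitaryGroup {ι : Type*} [Fintype ι] [DecidableEq ι] {A : Matrix ι ι ℂ}
    (hA : A.IsHermitian) (τ : ℝ) : evolution A τ ∈ Matrix.unitaryGroup ι ℂ := by
  let : NormedAlgebra ℚ (Matrix ι ι ℂ) := NormedAlgebra.restrictScalars ℚ ℂ _
  refine NormedSpace.exp_mem_unitary_of_mem_skewAdjoint ?_
  rw [skewAdjoint.mem_iff, star_smul, Matrix.star_eq_conjTranspose, hA.eq]
  simp

theorem norm_le_one_of_mem_unitaryGroup {ι : Type*} [Fintype ι] [DecidableEq ι]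
    {U : Matrix ι ι ℂ} (hU : U ∈ Matrix.unitaryGroup ι ℂ) : ‖U‖ ≤ 1 := by
  have h := CStarRing.norm_star_mul_self (x := U)
  rw [Matrix.mem_unitaryGroup_iff'.1 hU] at h
  have h1 : ‖(1 : Matrix ι ι ℂ)‖ ≤ 1 := by
    have h2 := CStarRing.norm_star_mul_self (x := (1 : Matrix ι ι ℂ))
    rw [star_one, mul_one] at h2
    nlinarith [norm_nonneg (1 : Matrix ι ι ℂ)]
  nlinarith [norm_nonneg U]

theorem evolution_unitary_conj {ι : Type*} [Fintype ι] [DecidableEq ι] {U : Matrix ι ι ℂ}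
    (hU : U ∈ Matrix.unitaryGroup ι ℂ) (A : Matrix ι ι ℂ) (τ : ℝ) :
    evolution (U * A * U.conjTranspose) τ = U * evolution A τ * U.conjTranspose := by
  have h := Matrix.exp_units_conj (Unitary.toUnits ⟨U, hU⟩) ((-(Complex.I * (τ : ℂ))) • A)
  have hinv : ((Unitary.toUnits ⟨U, hU⟩)⁻¹ : (Matrix ι ι ℂ)ˣ).val = U.conjTranspose := rfl
  have hval : (Unitary.toUnits ⟨U, hU⟩).val = U := rfl
  rw [hinv, hval] at h
  rw [evolution, evolution, ← h, Matrix.mul_smul, Matrix.smul_mul]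

theorem evolution_smul {ι : Type*} [Fintype ι] [DecidableEq ι] (A : Matrix ι ι ℂ) (N : ℕ)
    (τ : ℝ) : evolution ((1 / (N : ℂ)) • A) τ = evolution A (τ / N) := by
  rw [evolution, evolution, smul_smul]
  congr 2
  push_cast
  ring

theorem evolution_div_pow {ι : Type*} [Fintype ι] [DecidableEq ι] (A : Matrix ι ι ℂ) (τ : ℝ)
    {r : ℕ} (hr : 0 < r) : evolution A (τ / r) ^ r = evolution A τ := by
  rw [evolution, evolution, ← Matrix.exp_nsmul, ← Nat.cast_smul_eq_nsmul ℂ, smul_smul]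
  congr 2
  have : (r : ℂ) ≠ 0 := by exact_mod_cast hr.ne'
  push_cast
  field_simp

theorem isHermitian_finset_sum {ι κ : Type*} (s : Finset κ) {A : κ → Matrix ι ι ℂ}
    (hA : ∀ j ∈ s, (A j).IsHermitian) : (∑ j ∈ s, A j).IsHermitian := by
  rw [Matrix.IsHermitian, Matrix.conjTranspose_sum]
  exact Finset.sum_congr rfl hA

theorem IsLocalHamiltonian.isHermitian {n d k : ℕ} {H : Op n d} (hH : IsLocalHamiltonian k H) :
    H.IsHermitian := by
  obtain ⟨h, hh, rfl⟩ := hH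
  exact isHermitian_finset_sum _ fun S hS => (hh S (Finset.mem_filter.1 hS).2).2.1

section Terms

variable {n d N : ℕ} (M : Fin N → Fin n → Fin d × Fin d)

theorem isHermitian_ctrlTerm {H : Op n d} (hH : H.IsHermitian) (j : Fin N) :
    (ctrlTerm M H j).IsHermitian := by
  have h1 : ((1 : Matrix (Fin 2) (Fin 2) ℂ) ⊗ₖ H).IsHermitian := by
    rw [Matrix.IsHermitian, Matrix.conjTranspose_kronecker, hH.eq, Matrix.conjTranspose_one]
  have h2 := Matrix.isHermitian_mul_mul_conjTranspose (lam (pauliString (M j))) h1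
  rw [Matrix.IsHermitian, ctrlTerm, Matrix.conjTranspose_smul, h2.eq]
  simp

theorem norm_ctrlTerm_le [NeZero d] (H : Op n d) (j : Fin N) : ‖ctrlTerm M H j‖ ≤ ‖H‖ / N := by
  have hU := norm_le_one_of_mem_unitaryGroup
    (lam_mem_unitaryGroup (pauliString_mem_unitaryGroup (M j)))
  rw [ctrlTerm, norm_smul, norm_div, norm_one, Complex.norm_natCast, one_div, div_eq_inv_mul]
  gcongr
  calc _ ≤ ‖lam (pauliString (M j))‖ * ‖(1 : Matrix (Fin 2) (Fin 2) ℂ) ⊗ₖ H‖ *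
        ‖(lam (pauliString (M j))).conjTranspose‖ :=
          (norm_mul_le _ _).trans (by gcongr; exact norm_mul_le _ _)
    _ ≤ 1 * ‖H‖ * 1 := by
        rw [Matrix.l2_opNorm_conjTranspose]
        gcongr
        exact norm_one_kronecker_le H
    _ = ‖H‖ := by ring

/-- The terms add up to the controlled Hamiltonian: the twirl removes `H` from the block of the
control state `|0⟩`. -/
theorem sum_ctrlTerm (hN : 0 < N) {H : Op n d}
    (hH : ∑ j, pauliString (M j) * H * (pauliString (M j)).conjTranspose = 0) :
    ∑ j, ctrlTerm M H j = controlled (0, H) := by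
  have hterm : ∀ j, ctrlTerm M H j = controlled ((1 / (N : ℂ)) •
      (pauliString (M j) * H * (pauliString (M j)).conjTranspose, H)) := by
    intro j
    rw [ctrlTerm, one_kronecker_eq_controlled, conjTranspose_lam, lam_eq_controlled,
      lam_eq_controlled, ← map_mul, ← map_mul, Prod.mk_mul_mk, Prod.mk_mul_mk, one_mul, mul_one,
      ← map_smul]
  simp_rw [hterm]
  rw [← map_sum, ← Finset.smul_sum]
  congr 1
  have hN' : (N : ℂ) ≠ 0 := by exact_mod_cast hN.ne'
  refine Prod.ext ?_ ?_
  · rw [Prod.smul_fst, Prod.fst_sum, hH, smul_zero]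
  · rw [Prod.smul_snd, Prod.snd_sum, Finset.sum_const, Finset.card_univ, Fintype.card_fin,
      ← Nat.cast_smul_eq_nsmul ℂ, smul_smul, one_div, inv_mul_cancel₀ hN', one_smul]

end Terms

theorem evolution_controlled_zero {n d : ℕ} (H : Op n d) (τ : ℝ) :
    evolution (controlled (0, H)) τ = ctrl (evolution H τ) := by
  rw [evolution_controlled, evolution_zero, ctrl_eq_controlled]

/-! ### Circuits for the product formulas -/

section Circuits

variable {n d : ℕ}

theorem Circuit.toOp_append (c c' : Circuit n d) (H : Op n d) :
    Circuit.toOp (c ++ c') H = c.toOp H * c'.toOp H := by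
  simp [Circuit.toOp]

theorem Circuit.toOp_flatten (L : List (Circuit n d)) (H : Op n d) :
    Circuit.toOp L.flatten H = (L.map fun c => Circuit.toOp c H).prod := by
  induction L with
  | nil => simp [Circuit.toOp]
  | cons c L ih => rw [List.flatten_cons, toOp_append, ih, List.map_cons, List.prod_cons]

theorem Circuit.paulis_flatten (L : List (Circuit n d)) :
    Circuit.paulis L.flatten = (L.map Circuit.paulis).sum := by
  simp only [Circuit.paulis, List.countP_flatten]
  rfl

/-- The circuit `c`, repeated `r` times. -/
def Circuit.repeat (c : Circuit n d) (r : ℕ) : Circuit n d := (List.replicate r c).flatten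

theorem Circuit.toOp_repeat (c : Circuit n d) (r : ℕ) (H : Op n d) :
    (c.repeat r).toOp H = c.toOp H ^ r := by
  rw [Circuit.repeat, toOp_flatten, List.map_replicate, List.prod_replicate]

theorem Circuit.paulis_repeat (c : Circuit n d) (r : ℕ) :
    (c.repeat r).paulis = r * c.paulis := by
  rw [Circuit.repeat, paulis_flatten, List.map_replicate, List.sum_replicate, smul_eq_mul]

variable [NeZero d]

theorem Circuit.toOp_mem_unitaryGroup (c : Circuit n d) {H : Op n d} (hH : H.IsHermitian) :
    c.toOp H ∈ Matrix.unitaryGroup (Fin 2 × (Fin n → Fin d)) ℂ := by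
  refine Submonoid.list_prod_mem _ fun x hx => ?_
  obtain ⟨g, -, rfl⟩ := List.mem_map.1 hx
  cases g with
  | blackBox τ =>
    exact Matrix.kronecker_mem_unitary (one_mem _) (evolution_mem_unitaryGroup hH _)
  | ctrlPauli c m =>
    refine lam_mem_unitaryGroup ?_
    have hU := Matrix.mem_unitaryGroup_iff.1 (pauliString_mem_unitaryGroup m)
    rw [Matrix.mem_unitaryGroup_iff, star_smul, Matrix.smul_mul, Matrix.mul_smul, smul_smul, hU,
      omega_pow_mul_star, one_smul]

/-- The evolution under a term `(1/N) Λ(U) (I ⊗ H) Λ(U)†` takes two controlled generalized Paulis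
and one call of the black box. -/
theorem exists_circuit_ctrlTerm {N : ℕ} (M : Fin N → Fin n → Fin d × Fin d) (j : Fin N) {τ : ℝ}
    (hτ : 0 ≤ τ) :
    ∃ c : Circuit n d, c.paulis = 2 ∧ ∀ H, c.toOp H = evolution (ctrlTerm M H j) τ := by
  obtain ⟨c, m', hm'⟩ := exists_pauliString_conjTranspose (M j)
  refine ⟨[.ctrlPauli 0 (M j), .blackBox ⟨τ / N, by positivity⟩, .ctrlPauli c m'],
    rfl, fun H => ?_⟩
  rw [ctrlTerm, evolution_smul, evolution_unitary_conj
    (lam_mem_unitaryGroup (pauliString_mem_unitaryGroup (M j))), one_kronecker_eq_controlled,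
    evolution_controlled, ← one_kronecker_eq_controlled, conjTranspose_lam, hm']
  simp only [Circuit.toOp, Gate.toOp, mul_assoc, List.map_cons, List.map_nil,
    List.prod_cons, List.prod_nil, Fin.val_zero, pow_zero, one_smul, mul_one]
  rfl

theorem exists_circuit_trotter₁ {N : ℕ} (M : Fin N → Fin n → Fin d × Fin d) {t : ℝ} (ht : 0 ≤ t)
    (r : ℕ) :
    ∃ c : Circuit n d, c.paulis = r * (N * 2) ∧
      ∀ H, c.toOp H = trotter₁ (ctrlTerm M H) t r := by
  choose c hc hc' using fun j => exists_circuit_ctrlTerm M j (τ := t / r) (by positivity)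
  refine ⟨Circuit.repeat (List.ofFn c).reverse.flatten r, ?_, fun H => ?_⟩
  · rw [Circuit.paulis_repeat, Circuit.paulis_flatten, List.map_reverse, List.sum_reverse,
      List.map_ofFn, List.sum_ofFn]
    simp [hc]
  · rw [Circuit.toOp_repeat, Circuit.toOp_flatten, trotter₁, List.map_reverse, List.map_ofFn]
    simp only [Function.comp_def, hc']

theorem exists_circuit_trotter₂ {N : ℕ} (M : Fin N → Fin n → Fin d × Fin d) {t : ℝ} (ht : 0 ≤ t)
    (r : ℕ) :
    ∃ c : Circuit n d, c.paulis = r * (N * 4) ∧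
      ∀ H, c.toOp H = trotter₂ (ctrlTerm M H) t r := by
  choose c hc hc' using fun j => exists_circuit_ctrlTerm M j (τ := t / (2 * r)) (by positivity)
  refine ⟨Circuit.repeat (List.ofFn c ++ (List.ofFn c).reverse).flatten r, ?_, fun H => ?_⟩
  · rw [Circuit.paulis_repeat, Circuit.paulis_flatten, List.map_append, List.sum_append,
      List.map_reverse, List.sum_reverse, List.map_ofFn, List.sum_ofFn]
    simp [hc]
    ring_nf
    simp
  · rw [Circuit.toOp_repeat, Circuit.toOp_flatten, trotter₂, List.map_append, List.prod_append,
      List.map_reverse, List.map_ofFn]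
    simp only [Function.comp_def, hc']

end Circuits

/-! ### Errors of the Trotter formulas -/

section TrotterError

variable {ι : Type*} [Fintype ι] [DecidableEq ι] {N : ℕ} {A : Fin N → Matrix ι ι ℂ}

theorem list_prod_exp_mem_unitaryGroup (hA : ∀ j, (A j).IsHermitian) (τ : ℝ)
    {L : List (Matrix ι ι ℂ)} (hL : ∀ B ∈ L, ∃ j, B = (-(Complex.I * (τ : ℂ))) • A j) :
    (L.map NormedSpace.exp).prod ∈ Matrix.unitaryGroup ι ℂ := by
  refine Submonoid.list_prod_mem _ fun x hx => ?_
  obtain ⟨B, hB, rfl⟩ := List.mem_map.1 hx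
  obtain ⟨j, rfl⟩ := hL B hB
  exact evolution_mem_unitaryGroup (hA j) τ

theorem norm_neg_I_mul_smul (τ : ℝ) (hτ : 0 ≤ τ) (B : Matrix ι ι ℂ) :
    ‖(-(Complex.I * (τ : ℂ))) • B‖ = τ * ‖B‖ := by
  rw [norm_smul, norm_neg, norm_mul, Complex.norm_I, one_mul, Complex.norm_real,
    Real.norm_of_nonneg hτ]

variable [Nonempty ι]

/-- If one step of a product formula has the error `δ`, then `r` steps have at most the
error `r δ`. -/
theorem norm_pow_sub_evolution_le {B : Matrix ι ι ℂ} (hB : B.IsHermitian) {S : Matrix ι ι ℂ}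
    (hS : S ∈ Matrix.unitaryGroup ι ℂ) {t δ : ℝ} {r : ℕ} (hr : 0 < r)
    (hδ : ‖S - evolution B (t / r)‖ ≤ δ) : ‖S ^ r - evolution B t‖ ≤ r * δ := by
  rw [← evolution_div_pow B t hr]
  refine (norm_pow_sub_pow_le (norm_le_one_of_mem_unitaryGroup hS)
    (norm_le_one_of_mem_unitaryGroup (evolution_mem_unitaryGroup hB _)) r).trans ?_
  gcongr

/-- Error of the first-order Trotter formula: each of the `r` steps is a product formula with
exponents of total norm at most `t J / r`. -/
theorem norm_trotter₁_sub_le (hA : ∀ j, (A j).IsHermitian) {J : ℝ} (hJ : ∑ j, ‖A j‖ ≤ J)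
    {t : ℝ} (ht : 0 ≤ t) {r : ℕ} (hr : 0 < r) :
    ‖trotter₁ A t r - evolution (∑ j, A j) t‖ ≤ 2 * (t ^ 2 * J ^ 2) / r := by
  have hr' : (0 : ℝ) < r := by exact_mod_cast hr
  set τ : ℝ := t / r with hτ
  have hτ0 : 0 ≤ τ := by positivity
  set L : List (Matrix ι ι ℂ) :=
    (List.ofFn fun j => (-(Complex.I * (τ : ℂ))) • A j).reverse with hL
  have hprod : (L.map NormedSpace.exp).prod =
      (List.ofFn fun j => evolution (A j) τ).reverse.prod := by
    rw [hL, List.map_reverse, List.map_ofFn]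
    rfl
  have hsum : NormedSpace.exp L.sum = evolution (∑ j, A j) τ := by
    rw [hL, List.sum_reverse, List.sum_ofFn, ← Finset.smul_sum]
    rfl
  have hnorm : (L.map norm).sum ≤ τ * J := by
    rw [hL, List.map_reverse, List.sum_reverse, List.map_ofFn, List.sum_ofFn]
    simp only [Function.comp_apply, norm_neg_I_mul_smul τ hτ0, ← Finset.mul_sum]
    gcongr
  have hU : (L.map NormedSpace.exp).prod ∈ Matrix.unitaryGroup ι ℂ := by
    refine list_prod_exp_mem_unitaryGroup hA τ fun B hB => ?_
    rw [hL, List.mem_reverse, List.mem_ofFn] at hB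
    obtain ⟨j, rfl⟩ := hB
    exact ⟨j, rfl⟩
  have hstep : ‖(List.ofFn fun j => evolution (A j) τ).reverse.prod -
      evolution (∑ j, A j) τ‖ ≤ 2 * (τ * J) ^ 2 := by
    rw [← hprod, ← hsum]
    refine (norm_prod_exp_sub_exp_sum_le L (norm_le_one_of_mem_unitaryGroup hU) ?_).trans ?_
    · rw [hsum]
      exact norm_le_one_of_mem_unitaryGroup
        (evolution_mem_unitaryGroup (isHermitian_finset_sum _ fun j _ => hA j) _)
    · have := sum_map_norm_nonneg L
      gcongr
  refine (norm_pow_sub_evolution_le (isHermitian_finset_sum _ fun j _ => hA j)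
    (hprod ▸ hU) hr hstep).trans_eq ?_
  rw [hτ]
  field_simp

/-- Error of the second-order Trotter formula: each of the `r` steps is a symmetric product formula
with exponents of total norm at most `t J / r`. -/
theorem norm_trotter₂_sub_le (hA : ∀ j, (A j).IsHermitian) {J : ℝ} (hJ : ∑ j, ‖A j‖ ≤ J)
    {t : ℝ} (ht : 0 ≤ t) {r : ℕ} (hr : 0 < r) :
    ‖trotter₂ A t r - evolution (∑ j, A j) t‖ ≤ 2 * (t ^ 3 * J ^ 3) / r ^ 2 := by
  have hr' : (0 : ℝ) < r := by exact_mod_cast hr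
  set τ : ℝ := t / (2 * r) with hτ
  have hτ0 : 0 ≤ τ := by positivity
  have hττ : t / r = 2 * τ := by rw [hτ]; field_simp
  set L₀ : List (Matrix ι ι ℂ) := List.ofFn fun j => (-(Complex.I * (τ : ℂ))) • A j with hL₀
  set L : List (Matrix ι ι ℂ) := L₀ ++ L₀.reverse with hL
  have hrev : L.reverse = L := by rw [hL, List.reverse_append, List.reverse_reverse]
  have hprod : (L.map NormedSpace.exp).prod =
      (List.ofFn fun j => evolution (A j) τ).prod *
        (List.ofFn fun j => evolution (A j) τ).reverse.prod := by
    rw [hL, hL₀, List.map_append, List.prod_append, List.map_reverse, List.map_ofFn]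
    rfl
  have hsum : NormedSpace.exp L.sum = evolution (∑ j, A j) (t / r) := by
    rw [hL, hL₀, List.sum_append, List.sum_reverse, List.sum_ofFn, ← Finset.smul_sum, ← add_smul,
      evolution, hττ]
    congr 2
    push_cast
    ring
  have hnorm : (L.map norm).sum ≤ t / r * J := by
    rw [hL, hL₀, List.map_append, List.sum_append, List.map_reverse, List.sum_reverse,
      List.map_ofFn, List.sum_ofFn]
    simp only [Function.comp_apply, norm_neg_I_mul_smul τ hτ0, ← Finset.mul_sum]
    rw [hττ, mul_assoc, two_mul]
    gcongr
  have hU : (L.map NormedSpace.exp).prod ∈ Matrix.unitaryGroup ι ℂ := by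
    refine list_prod_exp_mem_unitaryGroup hA τ fun B hB => ?_
    rw [hL, List.mem_append, List.mem_reverse, or_self, hL₀, List.mem_ofFn] at hB
    obtain ⟨j, rfl⟩ := hB
    exact ⟨j, rfl⟩
  have hstep : ‖(List.ofFn fun j => evolution (A j) τ).prod *
        (List.ofFn fun j => evolution (A j) τ).reverse.prod -
      evolution (∑ j, A j) (t / r)‖ ≤ 2 * (t / r * J) ^ 3 := by
    rw [← hprod, ← hsum]
    refine (norm_prod_exp_sub_exp_sum_le_of_reverse_eq hrev
      (norm_le_one_of_mem_unitaryGroup hU) ?_).trans ?_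
    · rw [hsum]
      exact norm_le_one_of_mem_unitaryGroup
        (evolution_mem_unitaryGroup (isHermitian_finset_sum _ fun j _ => hA j) _)
    · have := sum_map_norm_nonneg L
      gcongr
  refine (norm_pow_sub_evolution_le (isHermitian_finset_sum _ fun j _ => hA j)
    (hprod ▸ hU) hr hstep).trans_eq ?_
  field_simp

end TrotterError

/-- A number of steps which is at least `2 x` and at most of the order `max 1 x`. -/
theorem exists_steps (x : ℝ) (hx : 0 ≤ x) : ∃ r : ℕ, 0 < r ∧ 2 * x ≤ r ∧ (r : ℝ) ≤ 4 * max 1 x := by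
  refine ⟨⌈2 * x⌉₊ + 1, Nat.succ_pos _, ?_, ?_⟩
  · push_cast
    linarith [Nat.le_ceil (2 * x)]
  · have h := (Nat.ceil_lt_add_one (by positivity : 0 ≤ 2 * x)).le
    push_cast
    linarith [le_max_left 1 x, le_max_right 1 x]

end Controlization

theorem mainTheorem4 (d : ℕ) (hd : 2 ≤ d) :
    ∃ C : ℝ, 0 < C ∧ ∀ n : ℕ, 1 ≤ n →
      ∃ (N : ℕ) (M : Fin N → Fin n → Fin d × Fin d),
        0 < N ∧ (N : ℝ) ≤ C * n ∧ Controlization.IsOrthogonalArray M 2 ∧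
        ∀ t J ε : ℝ, 0 ≤ t → 0 ≤ J → 0 < ε →
          (∃ (r : ℕ) (c : Controlization.Circuit n d), 0 < r ∧
            (c.paulis : ℝ) ≤ C * n * max 1 (t ^ 2 * J ^ 2 / ε) ∧
            ∀ H : Controlization.Op n d,
              Controlization.IsLocalHamiltonian 2 H → ‖H‖ ≤ J →
                c.toOp H = Controlization.trotter₁ (Controlization.ctrlTerm M H) t r ∧
                c.toOp H ∈ Matrix.unitaryGroup (Fin 2 × (Fin n → Fin d)) ℂ ∧
                ‖c.toOp H - Controlization.ctrl (Controlization.evolution H t)‖ ≤ ε) ∧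
          (∃ (r : ℕ) (c : Controlization.Circuit n d), 0 < r ∧
            (c.paulis : ℝ) ≤
              C * n * max 1 (t ^ (3 / 2 : ℝ) * J ^ (3 / 2 : ℝ) / ε ^ (1 / 2 : ℝ)) ∧
            ∀ H : Controlization.Op n d,
              Controlization.IsLocalHamiltonian 2 H → ‖H‖ ≤ J →
                c.toOp H = Controlization.trotter₂ (Controlization.ctrlTerm M H) t r ∧
                c.toOp H ∈ Matrix.unitaryGroup (Fin 2 × (Fin n → Fin d)) ℂ ∧
                ‖c.toOp H - Controlization.ctrl (Controlization.evolution H t)‖ ≤ ε) := by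
  open Controlization in
  have : NeZero d := ⟨by omega⟩
  obtain ⟨K, hK, harr⟩ := exists_linear_array (Fin d × Fin d)
  -- One step takes at most `4 N ≤ 4 K n` controlled Paulis, and `exists_steps` adds a factor `4`.
  refine ⟨16 * K, by positivity, fun n hn => ?_⟩
  obtain ⟨N, M, hN, hNK, hM⟩ := harr n hn
  have hNK' : (N : ℝ) ≤ K * n := by exact_mod_cast hNK
  have hN' : (0 : ℝ) < N := by exact_mod_cast hN
  have hsum : ∀ H : Op n d, IsLocalHamiltonian 2 H → ∀ t : ℝ,
      evolution (∑ j, ctrlTerm M H j) t = ctrl (evolution H t) := by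
    intro H hH t
    rw [sum_ctrlTerm M hN (sum_pauliString_conj_eq_zero_of_isLocalHamiltonian hM hH),
      evolution_controlled_zero]
  have hnorm : ∀ (H : Op n d) (J : ℝ), ‖H‖ ≤ J → ∑ j, ‖ctrlTerm M H j‖ ≤ J := by
    intro H J hJ
    calc ∑ j, ‖ctrlTerm M H j‖ ≤ ∑ _j : Fin N, ‖H‖ / N :=
          Finset.sum_le_sum fun j _ => norm_ctrlTerm_le M H j
      _ = ‖H‖ := by
          rw [Finset.sum_const, Finset.card_univ, Fintype.card_fin, nsmul_eq_mul]
          field_simp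
      _ ≤ J := hJ
  refine ⟨N, M, hN, ?_, fun S hS v => ?_, fun t J ε ht hJ hε => ⟨?_, ?_⟩⟩
  · have : (0 : ℝ) ≤ K * n := by positivity
    linarith
  · rw [← hS]
    exact hM S hS.le v
  · obtain ⟨r, hr, hr1, hr2⟩ := exists_steps (t ^ 2 * J ^ 2 / ε) (by positivity)
    have hr' : (0 : ℝ) < r := by exact_mod_cast hr
    obtain ⟨c, hc, hc'⟩ := exists_circuit_trotter₁ M ht r
    refine ⟨r, c, hr, ?_, fun H hH hHJ =>
      ⟨hc' H, c.toOp_mem_unitaryGroup hH.isHermitian, ?_⟩⟩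
    · set x := max 1 (t ^ 2 * J ^ 2 / ε)
      have hx : 0 ≤ x := zero_le_one.trans (le_max_left _ _)
      rw [hc]
      push_cast
      calc (r : ℝ) * (N * 2) ≤ 4 * x * (K * n * 2) := by gcongr
        _ ≤ 16 * K * n * x := by
          have : (0 : ℝ) ≤ K * n * x := by positivity
          linarith
    · rw [hc' H, ← hsum H hH]
      refine (norm_trotter₁_sub_le (isHermitian_ctrlTerm M hH.isHermitian) (hnorm H J hHJ)
        ht hr).trans ?_
      rw [div_le_iff₀ hr', ← div_le_iff₀' hε]
      calc _ = 2 * (t ^ 2 * J ^ 2 / ε) := by ring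
        _ ≤ r := hr1
  · set y := t ^ (3 / 2 : ℝ) * J ^ (3 / 2 : ℝ) / ε ^ (1 / 2 : ℝ) with hy
    have hy0 : 0 ≤ y := by positivity
    have hy2 : y ^ 2 = t ^ 3 * J ^ 3 / ε := by
      rw [hy, div_pow, mul_pow, ← Real.rpow_mul_natCast ht, ← Real.rpow_mul_natCast hJ,
        ← Real.rpow_mul_natCast hε.le, ← Real.rpow_natCast t, ← Real.rpow_natCast J]
      norm_num
    obtain ⟨r, hr, hr1, hr2⟩ := exists_steps y hy0
    have hr' : (0 : ℝ) < r := by exact_mod_cast hr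
    obtain ⟨c, hc, hc'⟩ := exists_circuit_trotter₂ M ht r
    refine ⟨r, c, hr, ?_, fun H hH hHJ =>
      ⟨hc' H, c.toOp_mem_unitaryGroup hH.isHermitian, ?_⟩⟩
    · have hx : 0 ≤ max 1 y := zero_le_one.trans (le_max_left _ _)
      rw [hc]
      push_cast
      calc (r : ℝ) * (N * 4) ≤ 4 * max 1 y * (K * n * 4) := by gcongr
        _ = 16 * K * n * max 1 y := by ring
    · rw [hc' H, ← hsum H hH]
      refine (norm_trotter₂_sub_le (isHermitian_ctrlTerm M hH.isHermitian) (hnorm H J hHJ)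
        ht hr).trans ?_
      rw [div_le_iff₀ (by positivity), ← div_le_iff₀' hε]
      calc _ = 2 * y ^ 2 := by rw [hy2]; ring
        _ ≤ (2 * y) ^ 2 := by nlinarith [sq_nonneg y]
        _ ≤ (r : ℝ) ^ 2 := by gcongr
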